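/- Consider arithmetical formulas in the language $0,1,+,\cdot,<,=$ with primitive $\neg,\wedge,\vee,\rightarrow,\exists,\forall$. A candidate witness is an infinite sequence of finite input-output pairs (lists of natural numbers, in which the inputs and outputs are listed in order of decreasing scope) and blank positions. For a candidate $W$ and a number $n$, let $W_n$ be obtained from $W$ by keeping the pairs whose list starts with $n$, deleting this $n$, and blanking all other positions; for a candidate $X$, let $W_X$ be obtained in the same way by keeping the pairs whose first entry is (the code of) an initial segment of $X$. Say that $W$ outputs $n$ if some pair of $W$ starts with $n$ and no pair starts with another number. Witnesses are defined by recursion: anything witnesses a true atomic sentence or a true negation, and nothing witnesses a false one; $W$ witnesses $A\wedge B$ iff $W_0$ witnesses $A$ and $W_1$ witnesses $B$; $W$ witnesses $A\vee B$ iff $W$ outputs $0$ and $W_0$ witnesses $A$, or $W$ outputs $1$ and $W_1$ witnesses $B$; $W$ witnesses $\exists x A(x)$ iff $W$ outputs some $n$ and $W_n$ witnesses $A(n)$; $W$ witnesses $\forall x A(x)$ iff $W_n$ witnesses $A(n)$ for every $n$; $W$ witnesses $A\rightarrow B$ iff $W_X$ witnesses $B$ for every $X$ witnessing $A$. A sentence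 $\varphi$ is constructively true, written $\Box\varphi$, if it has a recursive witness. Theorem 4. (a) Constructive arithmetical truth is $\Sigma^1_1$-hard: every set $S=\{n:\exists X\subseteq\mathbb N\ \varphi(n,X)\}$ with $\varphi$ arithmetical (using the set $X$ as a predicate) is many-one reducible, by a recursive function, to the set of Gödel numbers of constructively true arithmetical sentences. (b) Let $T$ be a recursive tree of finite sequences of natural numbers (a recursive set of sequences closed under initial segments). Let $R(n,m)$ be a universal $\Pi^0_1$ predicate, that is, a $\Pi^0_1$ predicate such that for every $\Pi^0_1$ predicate $Q(a,m)$ there is a recursive function $f$ with $Q(a,m)\leftrightarrow R(f(a),m)$ for all $a,m$; and let $P(n,m)$ be $R(n,m)\vee\neg R(n,m)$. Then $T$ has an infinite path if and only if $$\Box\,\forall n\,\Big(\big(\forall l\,\exists s\,(s\text{ is a sequence of length }l\wedge s\in T\wedge P(n,s))\rightarrow\exists s\,\exists t\,(s\text{ is incompatible with }t\wedge P(n,s)\wedge P(n,t))\big)\rightarrow S(n)\Big),$$ where $S(n)$ is $\exists c\,(c$ codes a non-tautological finite Boolean combination of $R(n,0),R(n,1),\ldots$ $\wedge\ \neg($the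 combination coded by $c$ is false$))$. Here sequences are identified with their codes, and incompatible means that neither extends the other. The formula $R(n,m)$ is $\forall z\,\delta(n,m,z)$; $\delta$ and the formulas for "$s$ has length $l$", "$s\in T$", "$s$ is incompatible with $t$" and "$c$ codes a non-tautological combination" are constructively decidable, where $\theta$ is constructively decidable if the universal closure of $\theta\vee\neg\theta$ is constructively true; and "the combination coded by $c$ is false" is any arithmetical formula defining that relation. Such formulas exist, and the equivalence holds for every choice of them. -/

import Mathlib

namespace ConstructiveTruth

/-! ## First-order arithmetic

Formulas are well-scoped: a `Formula k` has its free variables among `0, …, k - 1`, and a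
quantifier over a `Formula (k + 1)` binds the variable `k`. -/

/-- Terms of arithmetic with variables among `0, …, k - 1`. -/
inductive Term (k : ℕ) : Type
  | var : Fin k → Term k
  | zero : Term k
  | one : Term k
  | add : Term k → Term k → Term k
  | mul : Term k → Term k → Term k

/-- The value of a term in the natural numbers. -/
def Term.val {k : ℕ} (e : Fin k → ℕ) : Term k → ℕ
  | .var i => e i
  | .zero => 0
  | .one => 1
  | .add t u => t.val e + u.val e
  | .mul t u => t.val e * u.val e

/-- Renaming of variables in a term. -/
def Term.rename {k m : ℕ} (f : Fin k → Fin m) : Term k → Term m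
  | .var i => .var (f i)
  | .zero => .zero
  | .one => .one
  | .add t u => .add (t.rename f) (u.rename f)
  | .mul t u => .mul (t.rename f) (u.rename f)

/-- Arithmetical formulas; all connectives and quantifiers are primitive. -/
inductive Formula : ℕ → Type
  | eq {k : ℕ} : Term k → Term k → Formula k
  | lt {k : ℕ} : Term k → Term k → Formula k
  | neg {k : ℕ} : Formula k → Formula k
  | and {k : ℕ} : Formula k → Formula k → Formula k
  | or {k : ℕ} : Formula k → Formula k → Formula k
  | imp {k : ℕ} : Formula k → Formula k → Formula k
  | all {k : ℕ} : Formula (k + 1) → Formula k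
  | ex {k : ℕ} : Formula (k + 1) → Formula k

/-- Classical truth in the standard model, under an assignment of the free variables. -/
def Formula.Holds : {k : ℕ} → Formula k → (Fin k → ℕ) → Prop
  | _, .eq t u, e => t.val e = u.val e
  | _, .lt t u, e => t.val e < u.val e
  | _, .neg φ, e => ¬ φ.Holds e
  | _, .and φ ψ, e => φ.Holds e ∧ ψ.Holds e
  | _, .or φ ψ, e => φ.Holds e ∨ ψ.Holds e
  | _, .imp φ ψ, e => φ.Holds e → ψ.Holds e
  | _, .all φ, e => ∀ n : ℕ, φ.Holds (Fin.snoc e n)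
  | _, .ex φ, e => ∃ n : ℕ, φ.Holds (Fin.snoc e n)

/-- Extension of a renaming to one more (bound) variable. -/
def liftRenaming {k m : ℕ} (f : Fin k → Fin m) : Fin (k + 1) → Fin (m + 1) :=
  Fin.snoc (fun i => (f i).castSucc) (Fin.last m)

/-- Renaming of the free variables of a formula. -/
def Formula.rename : {k m : ℕ} → (Fin k → Fin m) → Formula k → Formula m
  | _, _, f, .eq t u => .eq (t.rename f) (u.rename f)
  | _, _, f, .lt t u => .lt (t.rename f) (u.rename f)
  | _, _, f, .neg φ => .neg (φ.rename f)
  | _, _, f, .and φ ψ => .and (φ.rename f) (ψ.rename f)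
  | _, _, f, .or φ ψ => .or (φ.rename f) (ψ.rename f)
  | _, _, f, .imp φ ψ => .imp (φ.rename f) (ψ.rename f)
  | _, _, f, .all φ => .all (φ.rename (liftRenaming f))
  | _, _, f, .ex φ => .ex (φ.rename (liftRenaming f))

/-- Universal closure. -/
def Formula.closure : {k : ℕ} → Formula k → Formula 0
  | 0, φ => φ
  | _ + 1, φ => Formula.closure (.all φ)

/-- Gödel numbers of terms. -/
def Term.code {k : ℕ} : Term k → ℕ
  | .var i => Nat.pair 0 i
  | .zero => Nat.pair 1 0
  | .one => Nat.pair 2 0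
  | .add t u => Nat.pair 3 (Nat.pair t.code u.code)
  | .mul t u => Nat.pair 4 (Nat.pair t.code u.code)

/-- Gödel numbers of formulas. -/
def Formula.code : {k : ℕ} → Formula k → ℕ
  | _, .eq t u => Nat.pair 0 (Nat.pair t.code u.code)
  | _, .lt t u => Nat.pair 1 (Nat.pair t.code u.code)
  | _, .neg φ => Nat.pair 2 φ.code
  | _, .and φ ψ => Nat.pair 3 (Nat.pair φ.code ψ.code)
  | _, .or φ ψ => Nat.pair 4 (Nat.pair φ.code ψ.code)
  | _, .imp φ ψ => Nat.pair 5 (Nat.pair φ.code ψ.code)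
  | _, .all φ => Nat.pair 6 φ.code
  | _, .ex φ => Nat.pair 7 φ.code

theorem Term.code_injective {k : ℕ} : Function.Injective (Term.code (k := k)) := by
  intro t
  induction t with
  | var i => intro u h; cases u <;> simp_all [Term.code, Nat.pair_eq_pair, Fin.ext_iff]
  | zero => intro u h; cases u <;> simp_all [Term.code, Nat.pair_eq_pair]
  | one => intro u h; cases u <;> simp_all [Term.code, Nat.pair_eq_pair]
  | add t u iht ihu =>
    intro v h
    cases v <;> simp [Term.code, Nat.pair_eq_pair] at h
    rw [iht h.1, ihu h.2]
  | mul t u iht ihu =>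
    intro v h
    cases v <;> simp [Term.code, Nat.pair_eq_pair] at h
    rw [iht h.1, ihu h.2]

theorem Formula.code_injective {k : ℕ} : Function.Injective (Formula.code (k := k)) := by
  intro φ
  induction φ with
  | eq t u =>
    intro v h
    cases v <;> simp [Formula.code, Nat.pair_eq_pair] at h
    rw [Term.code_injective h.1, Term.code_injective h.2]
  | lt t u =>
    intro v h
    cases v <;> simp [Formula.code, Nat.pair_eq_pair] at h
    rw [Term.code_injective h.1, Term.code_injective h.2]
  | neg φ ih =>
    intro v h
    cases v <;> simp [Formula.code, Nat.pair_eq_pair] at h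
    rw [ih h]
  | and φ ψ ih1 ih2 =>
    intro v h
    cases v <;> simp [Formula.code, Nat.pair_eq_pair] at h
    rw [ih1 h.1, ih2 h.2]
  | or φ ψ ih1 ih2 =>
    intro v h
    cases v <;> simp [Formula.code, Nat.pair_eq_pair] at h
    rw [ih1 h.1, ih2 h.2]
  | imp φ ψ ih1 ih2 =>
    intro v h
    cases v <;> simp [Formula.code, Nat.pair_eq_pair] at h
    rw [ih1 h.1, ih2 h.2]
  | all φ ih =>
    intro v h
    cases v <;> simp [Formula.code, Nat.pair_eq_pair] at h
    rw [ih h]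
  | ex φ ih =>
    intro v h
    cases v <;> simp [Formula.code, Nat.pair_eq_pair] at h
    rw [ih h]

/-! ## Witnesses and constructive truth -/

/-- The initial segment of length `l` of an infinite sequence. -/
def segment {α : Type} (f : ℕ → α) (l : ℕ) : List α := (List.range l).map f

/-- A candidate witness: an infinite sequence of input-output pairs, in arbitrary order, with
whitespace `none`. The inputs and outputs of a pair are listed in the order of decreasing scope of
the connectives and quantifiers they belong to; which entries are inputs and which are outputs is
determined by the formula. For `∀ x ∃ y (x = 2 * y ∨ x = 2 * y + 1)`, the list `[25, 12, 1]` is the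
pair with input `25` and outputs `12, 1`, and `[25, 12]` is a pair with less output. -/
abbrev Candidate : Type := ℕ → Option (List ℕ)

/-- Select the pairs of `W` that start with `n`, and remove `n` from them; all other positions
become whitespace. -/
def Candidate.strip (W : Candidate) (n : ℕ) : Candidate := fun k =>
  match W k with
  | some (a :: p) => if a = n then some p else none
  | _ => none

open Classical in
/-- `W` applied to `X`: select the pairs of `W` whose first input is (the code of) an initial
segment of `X` (whitespace included), and remove this input; all other positions become
whitespace. -/
noncomputable def Candidate.app (W X : Candidate) : Candidate := fun k =>
  match W k with
  | some (a :: p) => if ∃ l, a = Encodable.encode (segment X l) then some p else none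
  | _ => none

/-- `W` gives the output `n`, and no other one, as its first output. -/
def Candidate.Outputs (W : Candidate) (n : ℕ) : Prop :=
  (∃ k p, W k = some (n :: p)) ∧ ∀ k m p, W k = some (m :: p) → m = n

/-- `φ.Witnessed e W`: the sequence `W` is a witness for `φ` under the assignment `e`. -/
def Formula.Witnessed : {k : ℕ} → Formula k → (Fin k → ℕ) → Candidate → Prop
  | _, .eq t u, e, _ => t.val e = u.val e
  | _, .lt t u, e, _ => t.val e < u.val e
  | _, .neg φ, e, _ => ¬ φ.Holds e
  | _, .and φ ψ, e, W => φ.Witnessed e (W.strip 0) ∧ ψ.Witnessed e (W.strip 1)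
  | _, .or φ ψ, e, W =>
      (W.Outputs 0 ∧ φ.Witnessed e (W.strip 0)) ∨ (W.Outputs 1 ∧ ψ.Witnessed e (W.strip 1))
  | _, .imp φ ψ, e, W => ∀ X : Candidate, φ.Witnessed e X → ψ.Witnessed e (W.app X)
  | _, .all φ, e, W => ∀ n : ℕ, φ.Witnessed (Fin.snoc e n) (W.strip n)
  | _, .ex φ, e, W => ∃ n : ℕ, W.Outputs n ∧ φ.Witnessed (Fin.snoc e n) (W.strip n)

/-- A sentence is constructively true if it has a recursive witness. -/
def ConstructivelyTrue (φ : Formula 0) : Prop :=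
  ∃ W : Candidate, Computable W ∧ φ.Witnessed Fin.elim0 W

/-- Constructive arithmetical truth, as a set of Gödel numbers. -/
def ConstructiveTruthSet (c : ℕ) : Prop :=
  ∃ φ : Formula 0, φ.code = c ∧ ConstructivelyTrue φ

/-! ## `Σ¹₁` sets -/

/-- Arithmetical formulas with a unary predicate symbol `X` (over a classically complete set of
connectives and quantifiers). -/
inductive SetFormula : ℕ → Type
  | eq {k : ℕ} : Term k → Term k → SetFormula k
  | lt {k : ℕ} : Term k → Term k → SetFormula k
  | mem {k : ℕ} : Term k → SetFormula k
  | neg {k : ℕ} : SetFormula k → SetFormula k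
  | and {k : ℕ} : SetFormula k → SetFormula k → SetFormula k
  | all {k : ℕ} : SetFormula (k + 1) → SetFormula k

/-- Classical truth, with the predicate symbol interpreted by the set `X`. -/
def SetFormula.Holds (X : Set ℕ) : {k : ℕ} → SetFormula k → (Fin k → ℕ) → Prop
  | _, .eq t u, e => t.val e = u.val e
  | _, .lt t u, e => t.val e < u.val e
  | _, .mem t, e => t.val e ∈ X
  | _, .neg φ, e => ¬ φ.Holds X e
  | _, .and φ ψ, e => φ.Holds X e ∧ ψ.Holds X e
  | _, .all φ, e => ∀ n : ℕ, φ.Holds X (Fin.snoc e n)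

/-- `S` is `Σ¹₁`: it has the form `{n | ∃ X, φ(n, X)}` with `φ` arithmetical in `X`. -/
def IsSigma11 (S : Set ℕ) : Prop :=
  ∃ φ : SetFormula 1, ∀ n : ℕ, n ∈ S ↔ ∃ X : Set ℕ, φ.Holds X ![n]

/-! ## Universal `Π⁰₁` predicates, Boolean combinations, trees -/

/-- A binary relation on the natural numbers is `Π⁰₁` if its complement is recursively
enumerable. -/
def IsPi01 (Q : ℕ → ℕ → Prop) : Prop :=
  REPred fun p : ℕ × ℕ => ¬ Q p.1 p.2

/-- `R` is a universal `Π⁰₁` predicate: it is `Π⁰₁`, and indices with respect to `R` can be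
computed uniformly for every `Π⁰₁` family. -/
def IsUniversalPi01 (R : ℕ → ℕ → Prop) : Prop :=
  IsPi01 R ∧ ∀ Q : ℕ → ℕ → Prop, IsPi01 Q →
    ∃ f : ℕ → ℕ, Computable f ∧ ∀ a m : ℕ, Q a m ↔ R (f a) m

/-- Finite Boolean combinations of propositions number `0, 1, 2, …`. -/
inductive BoolComb : Type
  | atom : ℕ → BoolComb
  | neg : BoolComb → BoolComb
  | and : BoolComb → BoolComb → BoolComb
  | or : BoolComb → BoolComb → BoolComb

/-- Truth of a Boolean combination of the propositions `v 0, v 1, v 2, …`. -/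
def BoolComb.Eval (v : ℕ → Prop) : BoolComb → Prop
  | .atom i => v i
  | .neg b => ¬ b.Eval v
  | .and b c => b.Eval v ∧ c.Eval v
  | .or b c => b.Eval v ∨ c.Eval v

/-- A Boolean combination is tautological if it is true for all truth values of the atoms. -/
def BoolComb.Tautological (b : BoolComb) : Prop := ∀ v : ℕ → Prop, b.Eval v

/-- Codes of Boolean combinations. -/
def BoolComb.code : BoolComb → ℕ
  | .atom i => Nat.pair 0 i
  | .neg b => Nat.pair 1 b.code
  | .and b c => Nat.pair 2 (Nat.pair b.code c.code)
  | .or b c => Nat.pair 3 (Nat.pair b.code c.code)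

theorem BoolComb.code_injective : Function.Injective BoolComb.code := by
  intro b
  induction b with
  | atom i => intro c h; cases c <;> simp_all [BoolComb.code, Nat.pair_eq_pair]
  | neg b ih =>
    intro c h
    cases c <;> simp [BoolComb.code, Nat.pair_eq_pair] at h
    rw [ih h]
  | and b c ihb ihc =>
    intro d h
    cases d <;> simp [BoolComb.code, Nat.pair_eq_pair] at h
    rw [ihb h.1, ihc h.2]
  | or b c ihb ihc =>
    intro d h
    cases d <;> simp [BoolComb.code, Nat.pair_eq_pair] at h
    rw [ihb h.1, ihc h.2]

/-- A tree of finite sequences of natural numbers: closed under initial segments. -/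
def IsTree (T : Set (List ℕ)) : Prop := ∀ s t : List ℕ, s <+: t → t ∈ T → s ∈ T

/-- A recursive tree. -/
def IsRecursiveTree (T : Set (List ℕ)) : Prop :=
  IsTree T ∧ ComputablePred fun s : List ℕ => s ∈ T

/-- A tree is ill-founded if it has an infinite path. -/
def IllFounded (T : Set (List ℕ)) : Prop := ∃ g : ℕ → ℕ, ∀ l : ℕ, segment g l ∈ T

/-- Two finite sequences are incompatible if neither extends the other. -/
def Incompatible (s t : List ℕ) : Prop := ¬ s <+: t ∧ ¬ t <+: s

/-! ## The uniform implication -/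

/-- `φ` defines the relation `D` classically. -/
def Formula.Defines {k : ℕ} (φ : Formula k) (D : (Fin k → ℕ) → Prop) : Prop :=
  ∀ e : Fin k → ℕ, φ.Holds e ↔ D e

/-- `φ` is constructively decidable: the universal closure of `φ ∨ ¬ φ` is constructively true. -/
def Formula.Decidable {k : ℕ} (φ : Formula k) : Prop :=
  ConstructivelyTrue (Formula.closure (.or φ (.neg φ)))

/-- Formulas expressing the notions from which the uniform implication is built. Recursive notions
are expressed by constructively decidable formulas, and the universal `Π⁰₁` predicate by a
universal quantifier in front of a constructively decidable formula. -/
structure Presentation (T : Set (List ℕ)) where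
  /-- the sequence (with code) `s` has length `l`; variables `s, l` -/
  len : Formula 2
  /-- the sequence `s` belongs to `T` -/
  tree : Formula 1
  /-- the sequences `s` and `t` are incompatible; variables `s, t` -/
  incomp : Formula 2
  /-- the matrix of the universal `Π⁰₁` predicate `R(n, m)`; variables `n, m, z` -/
  matrix : Formula 3
  /-- `c` codes a non-tautological finite Boolean combination -/
  nontaut : Formula 1
  /-- the combination coded by `c` is false of `R(n, 0), R(n, 1), …`; variables `c, n` -/
  isFalse : Formula 2
  len_decidable : len.Decidable
  len_defines : len.Defines fun e => ∃ s : List ℕ, Encodable.encode s = e 0 ∧ s.length = e 1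
  tree_decidable : tree.Decidable
  tree_defines : tree.Defines fun e => ∃ s : List ℕ, Encodable.encode s = e 0 ∧ s ∈ T
  incomp_decidable : incomp.Decidable
  incomp_defines : incomp.Defines fun e =>
    ∃ s t : List ℕ, Encodable.encode s = e 0 ∧ Encodable.encode t = e 1 ∧ Incompatible s t
  matrix_decidable : matrix.Decidable
  matrix_universal : IsUniversalPi01 fun n m => (Formula.all matrix).Holds ![n, m]
  nontaut_decidable : nontaut.Decidable
  nontaut_defines : nontaut.Defines fun e => ∃ b : BoolComb, b.code = e 0 ∧ ¬ b.Tautological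
  isFalse_defines : isFalse.Defines fun e =>
    ∃ b : BoolComb, b.code = e 0 ∧ ¬ b.Eval fun i => (Formula.all matrix).Holds ![e 1, i]

namespace Presentation

variable {T : Set (List ℕ)} (D : Presentation T)

/-- `R(n, m) ∨ ¬ R(n, m)`, with `n` and `m` the variables `i` and `j`. -/
def dec {k : ℕ} (i j : Fin k) : Formula k :=
  Formula.rename ![i, j] (.or (.all D.matrix) (.neg (.all D.matrix)))

/-- `∀ l ∃ s (s has length l ∧ s ∈ T ∧ (R(n, s) ∨ ¬ R(n, s)))`; variables `n, l, s`. -/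
def branch : Formula 1 :=
  .all (.ex (.and (D.len.rename ![2, 1]) (.and (D.tree.rename ![2]) (D.dec 0 2))))

/-- `∃ s ∃ t (s, t are incompatible ∧ (R(n, s) ∨ ¬ R(n, s)) ∧ (R(n, t) ∨ ¬ R(n, t)))`;
variables `n, s, t`. -/
def split : Formula 1 :=
  .ex (.ex (.and (D.incomp.rename ![1, 2]) (.and (D.dec 0 1) (D.dec 0 2))))

/-- `∃ c (c is a non-tautological finite Boolean combination of R(n, 0), R(n, 1), … that is not
false)`; variables `n, c`. -/
def combination : Formula 1 :=
  .ex (.and (D.nontaut.rename ![1]) (.neg (D.isFalse.rename ![1, 0])))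

/-- `∀ n ((branch → split) → combination)`. -/
def statement : Formula 0 :=
  .all (.imp (.imp D.branch D.split) D.combination)

end Presentation

end ConstructiveTruth

namespace ConstructiveTruth

/-! ## Renaming and the semantics of witnesses -/

/-! Suppose that `g` is a path of `T` and that `X` witnesses the implication from `branch` to
`split` at `n`. Apply `X` to the witness of `branch` that selects the initial segments of `g` and
tells the truth about `R(n, ·)`. The result names incompatible `s` and `t`, so one of them, say `m`,
is not on `g`; yet `X` decides `R(n, m)` after reading finitely many values `R(n, g|l)`, `l < L`.
This yields a clause: if `R(n, ·)` has these values at the `g|l`, then it has that value at `m`. It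
is not a tautology, since `m` is none of the `g|l`. Neither `g` nor the truth values need be
recursive, so the witness searches through all `u ∈ T` and all finite lists of truth values, and
keeps the first clause found (`exists_clauseOf`). Every such clause is true (`eval_of_clauseOf`): if
the guessed values are wrong, its hypothesis fails; if they are right, the finite input extends to a
genuine witness of `branch`, so the decision by `X` is correct. Beyond the length of `u` the
extension follows `g`, even if `u` is not on `g`, because `branch` asks for no coherence between
different lengths. Thus `g` occurs only in the verification. Conversely, suppose that `T` has no
path. The sequences selected by a witness of `branch` cannot be pairwise compatible, so a search
finds two incompatible ones, and the implication has a recursive witness uniformly in `n`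
(`exists_uniform_split`). A recursive witness of `statement` would then compute from `n` a
non-tautological combination that is true of `R(n, 0), R(n, 1), …`. By the recursion theorem
(`IsUniversalPi01.exists_fixed_point`) there is an `n` for which `R(n, ·)` is a valuation falsifying
the very combination computed from `n`, a contradiction. For hardness, a `Σ¹₁` set is reduced to
ill-foundedness of recursive trees whose paths store truth values and counterexamples for the
subformulas of the defining formula (`IsSigma11.exists_trees`). The sentences for these trees have
computable Gödel numbers (`exists_presentations`). Constructively decidable formulas for recursive
relations come cheaply: anything witnesses a true negation, so deciding a double negation amounts to
producing one bit. -/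

theorem Term.val_rename {k m : ℕ} (f : Fin k → Fin m) (e : Fin m → ℕ) (t : Term k) :
    (t.rename f).val e = t.val (e ∘ f) := by
  induction t <;> simp_all [Term.rename, Term.val]

theorem snoc_comp_liftRenaming {k m : ℕ} (f : Fin k → Fin m) (e : Fin m → ℕ) (n : ℕ) :
    (Fin.snoc e n : Fin (m + 1) → ℕ) ∘ liftRenaming f = Fin.snoc (e ∘ f) n := by
  funext i
  refine Fin.lastCases ?_ (fun j => ?_) i <;> simp [liftRenaming]

theorem Formula.holds_rename {k : ℕ} (φ : Formula k) : ∀ {m : ℕ} (f : Fin k → Fin m)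
    (e : Fin m → ℕ), (φ.rename f).Holds e ↔ φ.Holds (e ∘ f) := by
  induction φ <;> intro m f e <;>
    simp_all [Formula.rename, Formula.Holds, Term.val_rename, snoc_comp_liftRenaming]

theorem Formula.witnessed_rename {k : ℕ} (φ : Formula k) : ∀ {m : ℕ} (f : Fin k → Fin m)
    (e : Fin m → ℕ) (W : Candidate),
    (φ.rename f).Witnessed e W ↔ φ.Witnessed (e ∘ f) W := by
  induction φ <;> intro m f e W <;>
    simp_all [Formula.rename, Formula.Witnessed, Term.val_rename, snoc_comp_liftRenaming,
      Formula.holds_rename]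

/-- The set of input-output pairs listed by a candidate. -/
def Candidate.pairs (W : Candidate) : Set (List ℕ) := {p | ∃ k, W k = some p}

theorem Candidate.mem_pairs {W : Candidate} {p : List ℕ} : p ∈ W.pairs ↔ ∃ k, W k = some p :=
  Iff.rfl

theorem Candidate.strip_eq_some {W : Candidate} {n k : ℕ} {p : List ℕ} :
    W.strip n k = some p ↔ W k = some (n :: p) := by
  unfold Candidate.strip
  rcases W k with _ | _ | ⟨a, q⟩ <;> simp

theorem Candidate.app_eq_some {W X : Candidate} {k : ℕ} {p : List ℕ} :
    W.app X k = some p ↔ ∃ l, W k = some (Encodable.encode (segment X l) :: p) := by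
  unfold Candidate.app
  rcases W k with _ | _ | ⟨a, q⟩ <;> simp

theorem Candidate.mem_pairs_strip {W : Candidate} {n : ℕ} {p : List ℕ} :
    p ∈ (W.strip n).pairs ↔ n :: p ∈ W.pairs := by
  simp [mem_pairs, strip_eq_some]

theorem Candidate.mem_pairs_app {W X : Candidate} {p : List ℕ} :
    p ∈ (W.app X).pairs ↔ ∃ l, Encodable.encode (segment X l) :: p ∈ W.pairs := by
  simp only [mem_pairs, app_eq_some]
  exact exists_comm

theorem Candidate.outputs_iff {W : Candidate} {n : ℕ} :
    W.Outputs n ↔ (∃ p, n :: p ∈ W.pairs) ∧ ∀ m p, m :: p ∈ W.pairs → m = n := by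
  simp only [Outputs, mem_pairs]
  constructor
  · rintro ⟨⟨k, p, h⟩, h'⟩
    exact ⟨⟨p, k, h⟩, fun m p ⟨k, h⟩ => h' k m p h⟩
  · rintro ⟨⟨p, k, h⟩, h'⟩
    exact ⟨⟨k, p, h⟩, fun k m p h => h' m p ⟨k, h⟩⟩

theorem Candidate.Outputs.unique {W : Candidate} {m n : ℕ} (hm : W.Outputs m)
    (hn : W.Outputs n) : m = n := by
  obtain ⟨k, p, h⟩ := hm.1
  exact hn.2 k m p h

/-- Stripping, application and output all read `W` through its set of pairs only, so order,
repetitions and blanks in `W` are irrelevant. The order in an argument `X` does matter, as its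
initial segments are inputs. -/
theorem Formula.witnessed_congr {k : ℕ} (φ : Formula k) : ∀ (e : Fin k → ℕ) {W W' : Candidate},
    W.pairs = W'.pairs → (φ.Witnessed e W ↔ φ.Witnessed e W') := by
  have strip {W W' : Candidate} (h : W.pairs = W'.pairs) (n : ℕ) :
      (W.strip n).pairs = (W'.strip n).pairs := by
    ext p; simp [Candidate.mem_pairs_strip, h]
  have app {W W' : Candidate} (h : W.pairs = W'.pairs) (X : Candidate) :
      (W.app X).pairs = (W'.app X).pairs := by
    ext p; simp [Candidate.mem_pairs_app, h]
  have out {W W' : Candidate} (h : W.pairs = W'.pairs) (n : ℕ) :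
      W.Outputs n ↔ W'.Outputs n := by
    simp [Candidate.outputs_iff, h]
  induction φ <;> intro e W W' h
  case eq => rfl
  case lt => rfl
  case neg => rfl
  case and φ ψ ihφ ihψ => exact and_congr (ihφ e (strip h 0)) (ihψ e (strip h 1))
  case or φ ψ ihφ ihψ =>
    exact or_congr (and_congr (out h 0) (ihφ e (strip h 0)))
      (and_congr (out h 1) (ihψ e (strip h 1)))
  case imp φ ψ _ ihψ => exact forall₂_congr fun X _ => ihψ e (app h X)
  case all φ ih => exact forall_congr' fun n => ih _ (strip h n)
  case ex φ ih => exact exists_congr fun n => and_congr (out h n) (ih _ (strip h n))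

/-! ## Combinators for candidates -/

namespace Candidate

/-- Output `n`, and then list `W`. -/
def out (n : ℕ) (W : Candidate) : Candidate := fun k =>
  k.casesOn (some [n]) fun j => (W j).map (n :: ·)

/-- Combine a sequence of candidates, selected by the first input. -/
def tabulate (W : ℕ → Candidate) : Candidate := fun k =>
  (W k.unpair.1 k.unpair.2).map (k.unpair.1 :: ·)

/-- Combine two candidates, selected by `0` and `1`. -/
def both (U W : Candidate) : Candidate :=
  tabulate fun n => n.casesOn U fun _ => W

/-- The candidate that lists, for each finite sequence `σ` on which `F` is defined, the pairs of
`B (F σ)` with the input `σ`. -/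
def respond {γ : Type} (F : List (Option (List ℕ)) → Option γ) (B : γ → Candidate) : Candidate :=
  tabulate fun n k => (F (Denumerable.ofNat (List (Option (List ℕ))) n)).bind fun c => B c k

theorem mem_pairs_out {n : ℕ} {W : Candidate} {p : List ℕ} :
    p ∈ (out n W).pairs ↔ p = [n] ∨ ∃ q ∈ W.pairs, p = n :: q := by
  simp only [mem_pairs, out]
  constructor
  · rintro ⟨_ | k, h⟩
    · left; simpa using h.symm
    · right; simp at h; grind
  · rintro (rfl | ⟨q, ⟨k, hk⟩, rfl⟩)
    · exact ⟨0, rfl⟩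
    · exact ⟨k + 1, by simp [hk]⟩

theorem mem_pairs_tabulate {W : ℕ → Candidate} {n : ℕ} {p : List ℕ} :
    n :: p ∈ (tabulate W).pairs ↔ p ∈ (W n).pairs := by
  simp only [mem_pairs, tabulate, Option.map_eq_some_iff, List.cons.injEq]
  constructor
  · rintro ⟨k, q, h, h1, rfl⟩
    exact ⟨_, h1 ▸ h⟩
  · rintro ⟨k, h⟩
    exact ⟨Nat.pair n k, p, by simpa using h, by simp⟩

theorem pairs_strip_tabulate (W : ℕ → Candidate) (n : ℕ) :
    ((tabulate W).strip n).pairs = (W n).pairs := by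
  ext p; rw [mem_pairs_strip, mem_pairs_tabulate]

theorem outputs_out (n : ℕ) (W : Candidate) : (out n W).Outputs n := by
  rw [outputs_iff]
  refine ⟨⟨[], mem_pairs_out.2 (Or.inl rfl)⟩, fun m p h => ?_⟩
  rcases mem_pairs_out.1 h with h | ⟨q, _, h⟩ <;> simp_all

/-- The pairs of `out n W` that start with `n`, except possibly for the empty remainder, are those
of `W`. -/
theorem cons_mem_pairs_out {n m : ℕ} {W : Candidate} {p : List ℕ} :
    n :: m :: p ∈ (out n W).pairs ↔ m :: p ∈ W.pairs := by
  simp [mem_pairs_out]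

end Candidate

/-- Empty pairs do not matter. -/
theorem Formula.witnessed_congr_cons {k : ℕ} (φ : Formula k) (e : Fin k → ℕ) {W W' : Candidate}
    (h : ∀ n p, n :: p ∈ W.pairs ↔ n :: p ∈ W'.pairs) :
    φ.Witnessed e W ↔ φ.Witnessed e W' := by
  have strip (n : ℕ) : (W.strip n).pairs = (W'.strip n).pairs := by
    ext p; simp [Candidate.mem_pairs_strip, h]
  have app (X : Candidate) : (W.app X).pairs = (W'.app X).pairs := by
    ext p; simp [Candidate.mem_pairs_app, h]
  have out (n : ℕ) : W.Outputs n ↔ W'.Outputs n := by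
    simp [Candidate.outputs_iff, h]
  cases φ with
  | eq => rfl
  | lt => rfl
  | neg => rfl
  | and φ ψ => exact and_congr (φ.witnessed_congr e (strip 0)) (ψ.witnessed_congr e (strip 1))
  | or φ ψ =>
    exact or_congr (and_congr (out 0) (φ.witnessed_congr e (strip 0)))
      (and_congr (out 1) (ψ.witnessed_congr e (strip 1)))
  | imp φ ψ => exact forall₂_congr fun X _ => ψ.witnessed_congr e (app X)
  | all φ => exact forall_congr' fun n => φ.witnessed_congr _ (strip n)
  | ex φ => exact exists_congr fun n => and_congr (out n) (φ.witnessed_congr _ (strip n))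

namespace Candidate

/-- The bare pair `[n]` guarantees the output even if `W` lists nothing; after stripping it becomes
an empty pair, which is harmless. -/
theorem witnessed_strip_out {k : ℕ} (φ : Formula k) (e : Fin k → ℕ) (n : ℕ) (W : Candidate) :
    φ.Witnessed e ((out n W).strip n) ↔ φ.Witnessed e W :=
  φ.witnessed_congr_cons e fun m p => by rw [mem_pairs_strip, cons_mem_pairs_out]

theorem witnessed_ex_out {k : ℕ} {φ : Formula (k + 1)} {e : Fin k → ℕ} {n : ℕ} {W : Candidate}
    (h : φ.Witnessed (Fin.snoc e n) W) : (Formula.ex φ).Witnessed e (out n W) :=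
  ⟨n, outputs_out n W, (witnessed_strip_out φ _ n W).2 h⟩

theorem witnessed_and_both {k : ℕ} {φ ψ : Formula k} {e : Fin k → ℕ} {U W : Candidate}
    (hφ : φ.Witnessed e U) (hψ : ψ.Witnessed e W) : (Formula.and φ ψ).Witnessed e (both U W) :=
  ⟨(φ.witnessed_congr e (pairs_strip_tabulate _ 0)).2 hφ,
    (ψ.witnessed_congr e (pairs_strip_tabulate _ 1)).2 hψ⟩

theorem witnessed_all_tabulate {k : ℕ} {φ : Formula (k + 1)} {e : Fin k → ℕ} {W : ℕ → Candidate}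
    (h : ∀ n, φ.Witnessed (Fin.snoc e n) (W n)) : (Formula.all φ).Witnessed e (tabulate W) :=
  fun n => (φ.witnessed_congr _ (pairs_strip_tabulate W n)).2 (h n)

theorem mem_pairs_app_respond {γ : Type} {F : List (Option (List ℕ)) → Option γ}
    {B : γ → Candidate} {X : Candidate} {p : List ℕ} :
    p ∈ ((respond F B).app X).pairs ↔ ∃ l c, F (segment X l) = some c ∧ p ∈ (B c).pairs := by
  rw [mem_pairs_app]
  refine exists_congr fun l => ?_
  rw [respond, mem_pairs_tabulate]
  simp only [mem_pairs, Denumerable.ofNat_encode, Option.bind_eq_some_iff]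
  grind

/-- Application collects the answers to all initial segments of `X` at once, so an `F` that is
defined on several of them must give the same answer each time. -/
theorem pairs_app_respond {γ : Type} {F : List (Option (List ℕ)) → Option γ}
    {B : γ → Candidate} {X : Candidate} {c : γ} (h : ∃ l, F (segment X l) = some c)
    (h' : ∀ l d, F (segment X l) = some d → d = c) :
    ((respond F B).app X).pairs = (B c).pairs := by
  ext p
  rw [mem_pairs_app_respond]
  constructor
  · rintro ⟨l, d, hd, hp⟩
    exact h' l d hd ▸ hp
  · intro hp
    obtain ⟨l, hl⟩ := h
    exact ⟨l, c, hl, hp⟩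

end Candidate

/-- A formula is classically true if and only if it has a witness. -/
theorem Formula.holds_iff_exists_witnessed {k : ℕ} (φ : Formula k) : ∀ e : Fin k → ℕ,
    φ.Holds e ↔ ∃ W, φ.Witnessed e W := by
  induction φ <;> intro e
  case eq => exact ⟨fun h => ⟨fun _ => none, h⟩, fun ⟨_, h⟩ => h⟩
  case lt => exact ⟨fun h => ⟨fun _ => none, h⟩, fun ⟨_, h⟩ => h⟩
  case neg => exact ⟨fun h => ⟨fun _ => none, h⟩, fun ⟨_, h⟩ => h⟩
  case and φ ψ ihφ ihψ =>
    rw [Formula.Holds, ihφ, ihψ]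
    constructor
    · rintro ⟨⟨U, hU⟩, W, hW⟩
      exact ⟨_, Candidate.witnessed_and_both hU hW⟩
    · rintro ⟨W, h0, h1⟩
      exact ⟨⟨_, h0⟩, _, h1⟩
  case or φ ψ ihφ ihψ =>
    rw [Formula.Holds, ihφ, ihψ]
    constructor
    · rintro (⟨W, hW⟩ | ⟨W, hW⟩)
      · exact ⟨_, Or.inl ⟨Candidate.outputs_out 0 W, (Candidate.witnessed_strip_out φ e 0 W).2 hW⟩⟩
      · exact ⟨_, Or.inr ⟨Candidate.outputs_out 1 W, (Candidate.witnessed_strip_out ψ e 1 W).2 hW⟩⟩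
    · rintro ⟨W, h | h⟩
      · exact Or.inl ⟨_, h.2⟩
      · exact Or.inr ⟨_, h.2⟩
  case imp φ ψ ihφ ihψ =>
    rw [Formula.Holds, ihφ, ihψ]
    constructor
    · intro h
      by_cases hφ : ∃ W, φ.Witnessed e W
      · obtain ⟨W, hW⟩ := h hφ
        -- The consequent has a witness outright, so the same `W` answers every input and nothing of
        -- `X` is read.
        refine ⟨Candidate.respond (fun _ => some ()) fun _ => W, fun X _ => ?_⟩
        rwa [ψ.witnessed_congr e (Candidate.pairs_app_respond (c := ()) ⟨0, rfl⟩ fun _ _ _ => rfl)]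
      · exact ⟨fun _ => none, fun X hX => (hφ ⟨X, hX⟩).elim⟩
    · rintro ⟨W, hW⟩ ⟨X, hX⟩
      exact ⟨_, hW X hX⟩
  case all φ ih =>
    simp only [Formula.Holds, ih]
    constructor
    · intro h
      choose W hW using h
      exact ⟨_, Candidate.witnessed_all_tabulate hW⟩
    · rintro ⟨W, hW⟩ n
      exact ⟨_, hW n⟩
  case ex φ ih =>
    simp only [Formula.Holds, ih]
    constructor
    · rintro ⟨n, W, hW⟩
      exact ⟨_, Candidate.witnessed_ex_out hW⟩
    · rintro ⟨W, n, _, h⟩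
      exact ⟨n, _, h⟩

theorem Formula.Witnessed.holds {k : ℕ} {φ : Formula k} {e : Fin k → ℕ} {W : Candidate}
    (h : φ.Witnessed e W) : φ.Holds e :=
  (φ.holds_iff_exists_witnessed e).2 ⟨W, h⟩

/-! ## Recursively enumerable predicates and primitive recursive candidates -/

/-- Running a program for `f` with a bound on the number of steps is primitive recursive. -/
theorem Partrec.exists_primrec_approximation {α σ : Type} [Primcodable α] [Primcodable σ]
    {f : α →. σ} (hf : Partrec f) :
    ∃ g : α → ℕ → Option σ, Primrec₂ g ∧ ∀ a b, b ∈ f a ↔ ∃ t, g a t = some b := by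
  obtain ⟨c, hc⟩ := Nat.Partrec.Code.exists_code.1 hf
  refine ⟨fun a t => (c.evaln t (Encodable.encode a)).bind Encodable.decode, ?_, fun a b => ?_⟩
  · exact Primrec.option_bind (Nat.Partrec.Code.primrec_evaln.comp
      (Primrec.pair (Primrec.pair Primrec.snd (Primrec.const c)) (Primrec.encode.comp Primrec.fst)))
      (Primrec.decode.comp Primrec.snd)
  · have h1 : c.eval (Encodable.encode a) = (f a).map Encodable.encode := by
      rw [hc]; simp
    have h2 : b ∈ f a ↔ Encodable.encode b ∈ c.eval (Encodable.encode a) := by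
      rw [h1, Part.mem_map_iff]
      constructor
      · exact fun h => ⟨b, h, rfl⟩
      · rintro ⟨b', h, h'⟩
        exact Encodable.encode_injective h' ▸ h
    have h3 (t : ℕ) (n : ℕ) (h : c.evaln t (Encodable.encode a) = some n) :
        ∃ b', b' ∈ f a ∧ n = Encodable.encode b' := by
      have := Nat.Partrec.Code.evaln_sound h
      rw [h1, Part.mem_map_iff] at this
      obtain ⟨b', hb', rfl⟩ := this
      exact ⟨b', hb', rfl⟩
    rw [h2, Nat.Partrec.Code.evaln_complete]
    refine exists_congr fun t => ?_
    rw [Option.bind_eq_some_iff]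
    constructor
    · exact fun h => ⟨_, h, Encodable.encodek b⟩
    · rintro ⟨n, h, h'⟩
      obtain ⟨b', _, rfl⟩ := h3 t n h
      rw [Encodable.encodek, Option.some_inj] at h'
      exact h' ▸ h

theorem REPred.exists_primrec {α : Type} [Primcodable α] {p : α → Prop} (hp : REPred p) :
    ∃ g : α → ℕ → Bool, Primrec₂ g ∧ ∀ a, p a ↔ ∃ t, g a t = true := by
  obtain ⟨g, hg, h⟩ := Partrec.exists_primrec_approximation hp
  refine ⟨fun a t => (g a t).isSome, Primrec.option_isSome.comp hg, fun a => ?_⟩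
  have := h a ()
  simp only [Part.mem_assert_iff, Part.mem_some_iff, exists_prop, and_true] at this
  rw [this]
  exact exists_congr fun t => by cases h : g a t <;> simp [h]

theorem REPred.of_exists_computable {α : Type} [Primcodable α] {p : α → Prop}
    {g : α → ℕ → Bool} (hg : Computable₂ g) (h : ∀ a, p a ↔ ∃ t, g a t = true) : REPred p := by
  have : Partrec fun a => Nat.rfindOpt fun t => if g a t = true then some () else none := by
    refine Partrec.rfindOpt ((Computable.cond hg (Computable.const (some ()))
      (Computable.const none)).of_eq fun x => ?_)
    beta_reduce; cases g x.1 x.2 <;> rfl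
  refine this.dom_re.of_eq fun a => ?_
  rw [h, Nat.rfindOpt_dom]
  simp

/-- Position `k` codes an element and a stage; the element is listed if it is confirmed at that
stage, and the position stays blank otherwise. -/
theorem REPred.exists_enumeration {α : Type} [Primcodable α] {p : α → Prop} (hp : REPred p) :
    ∃ w : ℕ → Option α, Primrec w ∧ ∀ a, p a ↔ ∃ k, w k = some a := by
  obtain ⟨g, hg, h⟩ := REPred.exists_primrec hp
  refine ⟨fun k => ((Encodable.decode k.unpair.1 : Option α)).bind fun a =>
    if g a k.unpair.2 = true then some a else none, ?_, fun a => ?_⟩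
  · refine Primrec.option_bind (Primrec.decode.comp (Primrec.fst.comp Primrec.unpair))
      (Primrec.ite (Primrec.primrecPred ?_) (Primrec.option_some.comp Primrec.snd)
        (Primrec.const none))
    refine (hg.comp Primrec.snd (Primrec.snd.comp (Primrec.unpair.comp Primrec.fst))).of_eq fun x => by simp
  · rw [h]
    constructor
    · rintro ⟨t, ht⟩
      exact ⟨Nat.pair (Encodable.encode a) t, by simp [ht]⟩
    · rintro ⟨k, hk⟩
      simp only [Option.bind_eq_some_iff, Option.ite_none_right_eq_some, Option.some_inj] at hk
      obtain ⟨_, _, h, rfl⟩ := hk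
      exact ⟨_, h⟩

/-- Every recursive candidate lists the same pairs as a primitive recursive one. -/
theorem Candidate.exists_primrec_pairs_eq {W : Candidate} (hW : Computable W) :
    ∃ W' : Candidate, Primrec W' ∧ W'.pairs = W.pairs := by
  have : REPred fun p : List ℕ => p ∈ W.pairs := by
    refine REPred.of_exists_computable (g := fun p k => decide (W k = some p)) ?_ fun p => ?_
    · exact (Primrec.eq (α := Option (List ℕ))).decide.to_comp.comp
        (hW.comp Computable.snd) (Computable.option_some.comp Computable.fst)
    · simp [Candidate.mem_pairs]
  obtain ⟨W', h, h'⟩ := REPred.exists_enumeration this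
  exact ⟨W', h, by ext p; exact (h' p).symm⟩

/-- Only the set of pairs matters, so a recursive witness may be slowed down by blanks until it is
primitive recursive. This keeps the later computability arguments within `Primrec`. -/
theorem ConstructivelyTrue.exists_primrec {φ : Formula 0} (h : ConstructivelyTrue φ) :
    ∃ W : Candidate, Primrec W ∧ φ.Witnessed Fin.elim0 W := by
  obtain ⟨W, hW, h⟩ := h
  obtain ⟨W', hW', h'⟩ := Candidate.exists_primrec_pairs_eq hW
  exact ⟨W', hW', (φ.witnessed_congr _ h').2 h⟩

namespace Candidate

/-! ### Primitive recursiveness of the combinators. -/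

section Primrec

variable {α γ : Type} [Primcodable α] [Primcodable γ]

theorem primrec_tabulate {W : α → ℕ → Candidate}
    (hW : Primrec fun x : (α × ℕ) × ℕ => W x.1.1 x.1.2 x.2) :
    Primrec₂ fun a => tabulate (W a) := by
  have h1 : Primrec fun x : α × ℕ => x.2.unpair.1 :=
    Primrec.fst.comp (Primrec.unpair.comp Primrec.snd)
  have h2 : Primrec fun x : α × ℕ => x.2.unpair.2 :=
    Primrec.snd.comp (Primrec.unpair.comp Primrec.snd)
  exact Primrec.option_map (hW.comp (Primrec.pair (Primrec.pair Primrec.fst h1) h2))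
    (Primrec.list_cons.comp (h1.comp Primrec.fst) Primrec.snd)

theorem primrec_out {n : α → ℕ} {W : α → Candidate} (hn : Primrec n) (hW : Primrec₂ W) :
    Primrec₂ fun a => out (n a) (W a) := by
  refine Primrec.nat_casesOn Primrec.snd
    (Primrec.option_some.comp (Primrec.list_cons.comp (hn.comp Primrec.fst) (Primrec.const [])))
    (Primrec.option_map (hW.comp (Primrec.fst.comp Primrec.fst) Primrec.snd)
      (Primrec.list_cons.comp (hn.comp (Primrec.fst.comp (Primrec.fst.comp Primrec.fst)))
        Primrec.snd))

theorem primrec_both {U W : α → Candidate} (hU : Primrec₂ U) (hW : Primrec₂ W) :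
    Primrec₂ fun a => both (U a) (W a) := by
  refine primrec_tabulate ((Primrec.nat_casesOn (Primrec.snd.comp Primrec.fst)
    (hU.comp (Primrec.fst.comp Primrec.fst) Primrec.snd)
    (hW.comp (Primrec.fst.comp (Primrec.fst.comp Primrec.fst))
      (Primrec.snd.comp Primrec.fst)).to₂).of_eq ?_)
  rintro ⟨⟨a, n⟩, k⟩
  cases n <;> rfl

theorem primrec_respond {F : α → List (Option (List ℕ)) → Option γ} {B : α → γ → Candidate}
    (hF : Primrec₂ F) (hB : Primrec fun x : (α × γ) × ℕ => B x.1.1 x.1.2 x.2) :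
    Primrec₂ fun a => respond (F a) (B a) := by
  refine primrec_tabulate (Primrec.option_bind
    (hF.comp (Primrec.fst.comp Primrec.fst)
      ((Primrec.ofNat _).comp (Primrec.snd.comp Primrec.fst)))
    (hB.comp (Primrec.pair (Primrec.pair (Primrec.fst.comp (Primrec.fst.comp Primrec.fst))
      Primrec.snd) (Primrec.snd.comp Primrec.fst))).to₂)

/-- Select the pairs of `W` that start with `l`, and remove `l` from them. -/
def stripList (W : Candidate) (l : List ℕ) : Candidate := fun k =>
  (W k).bind fun p => if p.take l.length = l then some (p.drop l.length) else none

theorem stripList_eq_some {W : Candidate} {l : List ℕ} {k : ℕ} {p : List ℕ} :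
    W.stripList l k = some p ↔ W k = some (l ++ p) := by
  simp only [stripList, Option.bind_eq_some_iff, Option.ite_none_right_eq_some, Option.some_inj]
  constructor
  · rintro ⟨q, hq, h1, rfl⟩
    rw [hq]
    congr
    conv_lhs => rw [← List.take_append_drop l.length q, h1]
  · intro h
    exact ⟨_, h, by simp, by simp⟩

theorem stripList_nil (W : Candidate) : W.stripList [] = W := by
  funext k
  ext p
  rw [stripList_eq_some, List.nil_append]

theorem stripList_concat (W : Candidate) (l : List ℕ) (n : ℕ) :
    W.stripList (l ++ [n]) = (W.stripList l).strip n := by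
  funext k
  ext p
  rw [stripList_eq_some, strip_eq_some, stripList_eq_some]
  simp

theorem primrec_stripList {W : Candidate} (hW : Primrec W) : Primrec₂ W.stripList := by
  have hlen : Primrec fun x : (List ℕ × ℕ) × List ℕ => x.1.1.length :=
    Primrec.list_length.comp (Primrec.fst.comp Primrec.fst)
  refine Primrec.option_bind (hW.comp Primrec.snd) (Primrec.ite (Primrec.eq.comp
    (Primrec.list_take.comp hlen Primrec.snd) (Primrec.fst.comp Primrec.fst))
    (Primrec.option_some.comp (Primrec.list_drop.comp hlen Primrec.snd)) (Primrec.const none)).to₂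

end Primrec

end Candidate

/-! ## Constructively decidable formulas -/

/-- The outermost quantifier of the closure binds variable `0`, so the inputs appear in the order of
`List.ofFn e`. -/
theorem Formula.witnessed_closure {k : ℕ} (φ : Formula k) (W : Candidate) :
    φ.closure.Witnessed Fin.elim0 W ↔
      ∀ e : Fin k → ℕ, φ.Witnessed e (W.stripList (List.ofFn e)) := by
  induction k with
  | zero =>
    constructor
    · intro h e
      rw [Subsingleton.elim e Fin.elim0]
      simpa [Candidate.stripList_nil, Formula.closure] using h
    · intro h
      simpa [Candidate.stripList_nil, Formula.closure] using h Fin.elim0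
  | succ k ih =>
    change (Formula.closure (.all φ)).Witnessed _ _ ↔ _
    rw [ih]
    have ofFn_snoc (e : Fin k → ℕ) (n : ℕ) : List.ofFn (Fin.snoc e n : Fin (k + 1) → ℕ) =
        List.ofFn e ++ [n] := by
      rw [List.ofFn_succ', List.concat_eq_append]
      simp
    constructor
    · intro h e
      have := h (Fin.init e) (e (Fin.last k))
      rwa [← Candidate.stripList_concat, ← ofFn_snoc, Fin.snoc_init_self] at this
    · intro h e n
      rw [← Candidate.stripList_concat, ← ofFn_snoc]
      exact h _

/-- The true instances of a constructively decidable formula are witnessed uniformly. -/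
theorem Formula.Decidable.exists_uniform {k : ℕ} {φ : Formula k} (hφ : φ.Decidable) :
    ∃ V : List ℕ → Candidate, Primrec₂ V ∧
      ∀ e : Fin k → ℕ, φ.Holds e → φ.Witnessed e (V (List.ofFn e)) := by
  obtain ⟨W, hW, h⟩ := hφ.exists_primrec
  rw [Formula.witnessed_closure] at h
  -- The entry `0` selects the left disjunct of `φ ∨ ¬ φ`; if `φ` holds, the right one cannot have
  -- been witnessed.
  refine ⟨fun l => W.stripList (l ++ [0]), (Candidate.primrec_stripList hW).comp
    (Primrec.list_append.comp Primrec.fst (Primrec.const [0])) Primrec.snd, fun e he => ?_⟩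
  beta_reduce
  rw [Candidate.stripList_concat]
  rcases h e with h | h
  · exact h.2
  · exact (h.2 he).elim

/-- A double negation is constructively decidable if its truth is a recursive predicate. -/
theorem Formula.decidable_neg_neg {k : ℕ} {φ : Formula k}
    (h : ComputablePred fun e : Fin k → ℕ => φ.Holds e) : (Formula.neg (.neg φ)).Decidable := by
  classical
  -- One pair for each assignment: the assignment and a bit for the disjunct. Below that bit nothing
  -- is needed, as both disjuncts are negations.
  let W : Candidate := fun j => (@Encodable.decode (Fin k → ℕ) Primcodable.toEncodable j).map fun e =>
    List.ofFn e ++ [if φ.Holds e then 0 else 1]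
  refine ⟨W, ?_, ?_⟩
  · refine Computable.option_map Computable.decode (Computable₂.comp (f := fun (l : List ℕ) a => l ++ [a])
      (g := fun x : ℕ × (Fin k → ℕ) => List.ofFn x.2)
      (h := fun x : ℕ × (Fin k → ℕ) => if φ.Holds x.2 then 0 else 1)
      Computable.list_concat ?_ ?_).to₂
    · exact Computable.list_ofFn (f := fun i (x : ℕ × (Fin k → ℕ)) => x.2 i)
        fun i => Computable.fin_app.comp Computable.snd (Computable.const i)
    · refine (Computable.cond (h.decide.comp Computable.snd) (Computable.const 0)
        (Computable.const 1)).of_eq fun x => ?_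
      simp [Bool.cond_decide]
  · rw [Formula.witnessed_closure]
    intro e
    have key (p : List ℕ) : p ∈ (W.stripList (List.ofFn e)).pairs ↔
        p = [if φ.Holds e then 0 else 1] := by
      simp only [Candidate.mem_pairs, Candidate.stripList_eq_some, W, Option.map_eq_some_iff]
      constructor
      · rintro ⟨j, e', _, h⟩
        obtain ⟨h1, h2⟩ := List.append_inj h (by simp)
        rw [List.ofFn_injective h1] at h2
        exact h2.symm
      · rintro rfl
        exact ⟨_, e, @Encodable.encodek (Fin k → ℕ) Primcodable.toEncodable e, rfl⟩
    by_cases he : φ.Holds e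
    · refine Or.inl ⟨Candidate.outputs_iff.2 ⟨⟨[], ?_⟩, fun m p => ?_⟩, fun h => h he⟩
      all_goals simp +contextual [key, he]
    · refine Or.inr ⟨Candidate.outputs_iff.2 ⟨⟨[], ?_⟩, fun m p => ?_⟩, fun h => h he⟩
      all_goals simp +contextual [key, he]

/-! ## Arithmetical definability of recursive predicates -/

/-- The relation `D` is arithmetical. -/
def Arithmetical {k : ℕ} (D : (Fin k → ℕ) → Prop) : Prop := ∃ φ : Formula k, φ.Defines D

/-- The graph of `f` is arithmetical. -/
def ArithmeticalFun {k : ℕ} (f : (Fin k → ℕ) → ℕ) : Prop :=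
  Arithmetical fun e : Fin (k + 1) → ℕ => e (Fin.last k) = f (Fin.init e)

namespace Arithmetical

variable {k : ℕ}

theorem of_iff {D D' : (Fin k → ℕ) → Prop} (h : Arithmetical D) (h' : ∀ e, D' e ↔ D e) :
    Arithmetical D' := by
  obtain ⟨φ, hφ⟩ := h
  exact ⟨φ, fun e => (hφ e).trans (h' e).symm⟩

theorem not {D : (Fin k → ℕ) → Prop} (h : Arithmetical D) : Arithmetical fun e => ¬ D e := by
  obtain ⟨φ, hφ⟩ := h
  exact ⟨.neg φ, fun e => not_congr (hφ e)⟩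

theorem and {D D' : (Fin k → ℕ) → Prop} (h : Arithmetical D) (h' : Arithmetical D') :
    Arithmetical fun e => D e ∧ D' e := by
  obtain ⟨φ, hφ⟩ := h
  obtain ⟨ψ, hψ⟩ := h'
  exact ⟨.and φ ψ, fun e => and_congr (hφ e) (hψ e)⟩

theorem or {D D' : (Fin k → ℕ) → Prop} (h : Arithmetical D) (h' : Arithmetical D') :
    Arithmetical fun e => D e ∨ D' e := by
  obtain ⟨φ, hφ⟩ := h
  obtain ⟨ψ, hψ⟩ := h'
  exact ⟨.or φ ψ, fun e => or_congr (hφ e) (hψ e)⟩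

theorem imp {D D' : (Fin k → ℕ) → Prop} (h : Arithmetical D) (h' : Arithmetical D') :
    Arithmetical fun e => D e → D' e := by
  obtain ⟨φ, hφ⟩ := h
  obtain ⟨ψ, hψ⟩ := h'
  exact ⟨.imp φ ψ, fun e => imp_congr (hφ e) (hψ e)⟩

theorem iff {D D' : (Fin k → ℕ) → Prop} (h : Arithmetical D) (h' : Arithmetical D') :
    Arithmetical fun e => D e ↔ D' e :=
  ((h.imp h').and (h'.imp h)).of_iff fun _ => iff_iff_implies_and_implies

theorem ex {P : (Fin k → ℕ) → ℕ → Prop}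
    (h : Arithmetical fun e : Fin (k + 1) → ℕ => P (Fin.init e) (e (Fin.last k))) :
    Arithmetical fun e => ∃ n, P e n := by
  obtain ⟨φ, hφ⟩ := h
  exact ⟨.ex φ, fun e => exists_congr fun n => by simpa using hφ (Fin.snoc e n)⟩

theorem all {P : (Fin k → ℕ) → ℕ → Prop}
    (h : Arithmetical fun e : Fin (k + 1) → ℕ => P (Fin.init e) (e (Fin.last k))) :
    Arithmetical fun e => ∀ n, P e n := by
  obtain ⟨φ, hφ⟩ := h
  exact ⟨.all φ, fun e => forall_congr' fun n => by simpa using hφ (Fin.snoc e n)⟩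

theorem rename {m : ℕ} {D : (Fin k → ℕ) → Prop} (h : Arithmetical D) (f : Fin k → Fin m) :
    Arithmetical fun e : Fin m → ℕ => D (e ∘ f) := by
  obtain ⟨φ, hφ⟩ := h
  exact ⟨φ.rename f, fun e => (φ.holds_rename f e).trans (hφ _)⟩

theorem eq_val (i : Fin k) (t : Term k) : Arithmetical fun e => e i = t.val e :=
  ⟨.eq (.var i) t, fun _ => Iff.rfl⟩

/-- Formulas have no terms for general functions, so the value is introduced by an existential
quantifier through the graph of `f`. -/
theorem subst {P : (Fin k → ℕ) → ℕ → Prop} {f : (Fin k → ℕ) → ℕ}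
    (h : Arithmetical fun e : Fin (k + 1) → ℕ => P (Fin.init e) (e (Fin.last k)))
    (hf : ArithmeticalFun f) : Arithmetical fun e => P e (f e) :=
  (ex (P := fun e n => n = f e ∧ P e n) (hf.and h)).of_iff fun e => by simp

end Arithmetical

namespace ArithmeticalFun

variable {k : ℕ}

theorem var (i : Fin k) : ArithmeticalFun fun e => e i :=
  Arithmetical.eq_val (Fin.last k) (.var i.castSucc)

theorem last : ArithmeticalFun fun e : Fin (k + 1) → ℕ => e (Fin.last k) := var _

theorem weaken {f : (Fin k → ℕ) → ℕ} (hf : ArithmeticalFun f) :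
    ArithmeticalFun fun e : Fin (k + 1) → ℕ => f (Fin.init e) := by
  refine (Arithmetical.rename hf
    (Fin.snoc (fun i => i.castSucc.castSucc) (Fin.last (k + 1)))).of_iff fun e => ?_
  simp only [Function.comp_apply, Fin.snoc_last]
  have : Fin.init (e ∘ (Fin.snoc (fun i => i.castSucc.castSucc) (Fin.last (k + 1)) :
      Fin (k + 1) → Fin (k + 2))) = Fin.init (Fin.init e) := by
    funext i; simp [Fin.init]
  rw [this]

end ArithmeticalFun

namespace Arithmetical

variable {k : ℕ} {f g h : (Fin k → ℕ) → ℕ}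

theorem rel₂ {R : ℕ → ℕ → Prop} (hR : Arithmetical fun e : Fin 2 → ℕ => R (e 0) (e 1))
    (hf : ArithmeticalFun f) (hg : ArithmeticalFun g) : Arithmetical fun e => R (f e) (g e) :=
  subst (P := fun e z => R (f e) z) (subst (P := fun e y => R y (e (Fin.last k)))
    (hR.rename ![Fin.last (k + 1), (Fin.last k).castSucc]) hf.weaken) hg

theorem rel₃ {R : ℕ → ℕ → ℕ → Prop}
    (hR : Arithmetical fun e : Fin 3 → ℕ => R (e 0) (e 1) (e 2)) (hf : ArithmeticalFun f)
    (hg : ArithmeticalFun g) (hh : ArithmeticalFun h) :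
    Arithmetical fun e => R (f e) (g e) (h e) :=
  subst (P := fun e z => R (f e) (g e) z)
    (subst (P := fun e y => R (f (Fin.init e)) y (e (Fin.last k)))
      (subst (P := fun e x => R x (e (Fin.last (k + 1))) (Fin.init e (Fin.last k)))
        (hR.rename ![Fin.last (k + 2), (Fin.last (k + 1)).castSucc,
          (Fin.last k).castSucc.castSucc]) hf.weaken.weaken) hg.weaken) hh

theorem eq (hf : ArithmeticalFun f) (hg : ArithmeticalFun g) : Arithmetical fun e => f e = g e :=
  rel₂ (R := fun x y => x = y) ⟨.eq (.var 0) (.var 1), fun _ => Iff.rfl⟩ hf hg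

theorem lt (hf : ArithmeticalFun f) (hg : ArithmeticalFun g) : Arithmetical fun e => f e < g e :=
  rel₂ (R := fun x y => x < y) ⟨.lt (.var 0) (.var 1), fun _ => Iff.rfl⟩ hf hg

end Arithmetical

namespace ArithmeticalFun

variable {k : ℕ} {f g : (Fin k → ℕ) → ℕ}

theorem comp₁ {F : ℕ → ℕ} (hF : Arithmetical fun e : Fin 2 → ℕ => e 1 = F (e 0))
    (hf : ArithmeticalFun f) : ArithmeticalFun fun e => F (f e) :=
  Arithmetical.rel₂ (R := fun x y => y = F x) hF hf.weaken last

theorem comp₂ {F : ℕ → ℕ → ℕ} (hF : Arithmetical fun e : Fin 3 → ℕ => e 2 = F (e 0) (e 1))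
    (hf : ArithmeticalFun f) (hg : ArithmeticalFun g) : ArithmeticalFun fun e => F (f e) (g e) :=
  Arithmetical.rel₃ (R := fun x y z => z = F x y) hF hf.weaken hg.weaken last

theorem zero : ArithmeticalFun fun _ : Fin k → ℕ => 0 := Arithmetical.eq_val _ .zero

theorem one : ArithmeticalFun fun _ : Fin k → ℕ => 1 := Arithmetical.eq_val _ .one

theorem add (hf : ArithmeticalFun f) (hg : ArithmeticalFun g) :
    ArithmeticalFun fun e => f e + g e :=
  comp₂ (Arithmetical.eq_val 2 (.add (.var 0) (.var 1))) hf hg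

theorem mul (hf : ArithmeticalFun f) (hg : ArithmeticalFun g) :
    ArithmeticalFun fun e => f e * g e :=
  comp₂ (Arithmetical.eq_val 2 (.mul (.var 0) (.var 1))) hf hg

theorem pair (hf : ArithmeticalFun f) (hg : ArithmeticalFun g) :
    ArithmeticalFun fun e => Nat.pair (f e) (g e) := by
  refine comp₂ (F := Nat.pair) (((Arithmetical.lt (var 0) (var 1)).and
    (Arithmetical.eq (var 2) (((var 1).mul (var 1)).add (var 0)))).or
    ((Arithmetical.lt (var 0) (var 1)).not.and (Arithmetical.eq (var 2)
    ((((var 0).mul (var 0)).add (var 0)).add (var 1)))) |>.of_iff fun e => ?_) hf hg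
  unfold Nat.pair
  split_ifs with h <;> simp [h]

theorem unpair_fst (hf : ArithmeticalFun f) : ArithmeticalFun fun e => (f e).unpair.1 := by
  refine comp₁ (F := fun n => n.unpair.1) ((Arithmetical.ex
    (P := fun e b => Nat.pair (e 1) b = e 0)
    (Arithmetical.eq ((var 1).pair last) (var 0))).of_iff fun e => ?_) hf
  constructor
  · intro h; exact ⟨(e 0).unpair.2, by rw [h, Nat.pair_unpair]⟩
  · rintro ⟨b, h⟩; rw [← h, Nat.unpair_pair]

theorem unpair_snd (hf : ArithmeticalFun f) : ArithmeticalFun fun e => (f e).unpair.2 := by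
  refine comp₁ (F := fun n => n.unpair.2) ((Arithmetical.ex
    (P := fun e b => Nat.pair b (e 1) = e 0)
    (Arithmetical.eq (last.pair (var 1)) (var 0))).of_iff fun e => ?_) hf
  constructor
  · intro h; exact ⟨(e 0).unpair.1, by rw [h, Nat.pair_unpair]⟩
  · rintro ⟨b, h⟩; rw [← h, Nat.unpair_pair]

/-- The moduli in Gödel's β function are successors, so this form of the remainder suffices and is
never a remainder modulo `0`. -/
theorem mod_succ (hf : ArithmeticalFun f) (hg : ArithmeticalFun g) :
    ArithmeticalFun fun e => f e % (g e + 1) := by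
  refine comp₂ (F := fun a b => a % (b + 1)) (((Arithmetical.lt (var 2) ((var 1).add one)).and
    (Arithmetical.ex (P := fun e q => e 0 = (e 1 + 1) * q + e 2)
    (Arithmetical.eq (var 0) ((((var 1).add one).mul last).add (var 2))))).of_iff fun e => ?_) hf hg
  constructor
  · intro h
    rw [h]
    exact ⟨Nat.mod_lt _ (Nat.succ_pos _), e 0 / (e 1 + 1), (Nat.div_add_mod _ _).symm⟩
  · rintro ⟨h, q, hq⟩
    rw [hq, Nat.mul_add_mod, Nat.mod_eq_of_lt h]

theorem beta (hf : ArithmeticalFun f) (hg : ArithmeticalFun g) :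
    ArithmeticalFun fun e => Nat.beta (f e) (g e) :=
  hf.unpair_fst.mod_succ ((hg.add one).mul hf.unpair_snd)

end ArithmeticalFun

theorem exists_beta_eq (v : ℕ → ℕ) (n : ℕ) : ∃ w, ∀ m ≤ n, Nat.beta w m = v m := by
  refine ⟨Nat.unbeta ((List.range (n + 1)).map v), fun m hm => ?_⟩
  have := Nat.beta_unbeta_coe ((List.range (n + 1)).map v) ⟨m, by simp; omega⟩
  simpa using this

/-- Computations by primitive recursion are coded by single numbers. -/
theorem mem_rec_iff_exists_beta (f : Part ℕ) (g : ℕ → ℕ →. ℕ) (n y : ℕ) :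
    y ∈ (n.rec f fun m IH => IH.bind (g m) : Part ℕ) ↔
      ∃ w, Nat.beta w 0 ∈ f ∧ (∀ m, m < n → Nat.beta w (m + 1) ∈ g m (Nat.beta w m)) ∧
        Nat.beta w n = y := by
  constructor
  · intro h
    -- The course of values is first built as a function, which is easily extended by one value, and
    -- only then coded by a number.
    have : ∃ v : ℕ → ℕ, v 0 ∈ f ∧ (∀ m, m < n → v (m + 1) ∈ g m (v m)) ∧ v n = y := by
      induction n generalizing y with
      | zero => exact ⟨fun _ => y, h, by simp, rfl⟩
      | succ n ih =>
        obtain ⟨x, hx, hy⟩ := Part.mem_bind_iff.1 h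
        obtain ⟨v, h0, h1, h2⟩ := ih x hx
        refine ⟨fun m => if m ≤ n then v m else y, by simpa using h0, fun m hm => ?_, by simp⟩
        rcases Nat.lt_succ_iff_lt_or_eq.1 hm with hm | rfl
        · simpa [hm.le, Nat.succ_le_of_lt hm] using h1 m hm
        · simpa [h2] using hy
    obtain ⟨v, h0, h1, h2⟩ := this
    obtain ⟨w, hw⟩ := exists_beta_eq v n
    refine ⟨w, by rwa [hw 0 (Nat.zero_le _)], fun m hm => ?_, by rw [hw n le_rfl, h2]⟩
    rw [hw m hm.le, hw (m + 1) hm]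
    exact h1 m hm
  · rintro ⟨w, h0, h1, rfl⟩
    induction n with
    | zero => exact h0
    | succ n ih =>
      exact Part.mem_bind_iff.2 ⟨_, ih fun m hm => h1 m (by omega), h1 n (by omega)⟩

open ArithmeticalFun in
/-- The graph of a partial recursive function is arithmetical. -/
theorem Arithmetical.of_partrec {f : ℕ →. ℕ} (hf : Nat.Partrec f) :
    Arithmetical fun e : Fin 2 → ℕ => e 1 ∈ f (e 0) := by
  induction hf with
  | zero => exact (Arithmetical.eq (var 1) zero).of_iff fun e => by simp [pure, PFun.pure]
  | succ => exact (Arithmetical.eq (var 1) ((var 0).add one)).of_iff fun e => by simp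
  | left => exact (Arithmetical.eq (var 1) (var 0).unpair_fst).of_iff fun e => by simp
  | right => exact (Arithmetical.eq (var 1) (var 0).unpair_snd).of_iff fun e => by simp
  | @pair f g _ _ ihf ihg =>
    refine (Arithmetical.ex (P := fun e a => ∃ b, a ∈ f (e 0) ∧ b ∈ g (e 0) ∧
      e 1 = Nat.pair a b) (Arithmetical.ex ?_)).of_iff fun e => ?_
    · exact (rel₂ (R := fun x y => y ∈ f x) ihf (var 0) (var 2)).and
        ((rel₂ (R := fun x y => y ∈ g x) ihg (var 0) (var 3)).and
        (Arithmetical.eq (var 1) ((var 2).pair (var 3))))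
    · simp [Seq.seq, eq_comm]
  | @comp f g _ _ ihf ihg =>
    refine (Arithmetical.ex (P := fun e a => a ∈ g (e 0) ∧ e 1 ∈ f a) ?_).of_iff fun e => ?_
    · exact (rel₂ (R := fun x y => y ∈ g x) ihg (var 0) (var 2)).and
        (rel₂ (R := fun x y => y ∈ f x) ihf (var 2) (var 1))
    · exact Part.mem_bind_iff
  | @prec f g _ _ ihf ihg =>
    -- `w` codes the course of values of the recursion.
    refine (Arithmetical.ex (P := fun e w => Nat.beta w 0 ∈ f (e 0).unpair.1 ∧
      (∀ m, m < (e 0).unpair.2 → Nat.beta w (m + 1) ∈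
        g (Nat.pair (e 0).unpair.1 (Nat.pair m (Nat.beta w m)))) ∧
      Nat.beta w (e 0).unpair.2 = e 1) ?_).of_iff fun e => ?_
    · exact (rel₂ (R := fun x y => y ∈ f x) ihf (var 0).unpair_fst ((var 2).beta zero)).and
        ((Arithmetical.all ((Arithmetical.lt (var 3) (var 0).unpair_snd).imp
          (rel₂ (R := fun x y => y ∈ g x) ihg
            ((var 0).unpair_fst.pair ((var 3).pair ((var 2).beta (var 3))))
            ((var 2).beta ((var 3).add one))))).and
        (Arithmetical.eq ((var 2).beta (var 0).unpair_snd) (var 1)))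
    · exact mem_rec_iff_exists_beta _ (fun m i => g (Nat.pair (e 0).unpair.1 (Nat.pair m i))) _ _
  | @rfind f _ ih =>
    -- Below the least zero, `f` must be defined as well as nonzero.
    refine ((rel₂ (R := fun x y => y ∈ f x) ih ((var 0).pair (var 1)) zero).and
      (Arithmetical.all (P := fun e m => m < e 1 → ∃ v, v ∈ f (Nat.pair (e 0) m) ∧ ¬ v = 0)
        ((Arithmetical.lt (var 2) (var 1)).imp (Arithmetical.ex ?_)))).of_iff fun e => ?_
    · exact (rel₂ (R := fun x y => y ∈ f x) ih ((var 0).pair (var 2)) (var 3)).and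
        (Arithmetical.eq (var 3) zero).not
    · refine Nat.mem_rfind.trans (and_congr ?_ (forall₂_congr fun m _ => ?_)) <;>
        simp

/-- Code of a tuple. -/
def tupleCode : {k : ℕ} → (Fin k → ℕ) → ℕ
  | 0, _ => 0
  | _ + 1, e => Nat.pair (tupleCode (Fin.init e)) (e (Fin.last _))

/-- Tuple with a given code. -/
def tuple : (k : ℕ) → ℕ → Fin k → ℕ
  | 0, _ => Fin.elim0
  | k + 1, n => Fin.snoc (tuple k n.unpair.1) n.unpair.2

theorem tuple_pair (k c n : ℕ) : tuple (k + 1) (Nat.pair c n) = Fin.snoc (tuple k c) n := by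
  simp [tuple]

theorem tuple_tupleCode {k : ℕ} (e : Fin k → ℕ) : tuple k (tupleCode e) = e := by
  induction k with
  | zero => exact Subsingleton.elim _ _
  | succ k ih => simp [tuple, tupleCode, ih]

theorem primrec_tuple_apply {k : ℕ} (i : Fin k) : Primrec fun n => tuple k n i := by
  induction k with
  | zero => exact i.elim0
  | succ k ih =>
    refine Fin.lastCases ?_ (fun i => ?_) i
    · exact (Primrec.snd.comp Primrec.unpair).of_eq fun n => by simp [tuple]
    · exact ((ih i).comp (Primrec.fst.comp Primrec.unpair)).of_eq fun n => by simp [tuple]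

theorem primrec_tuple (k : ℕ) : Primrec (tuple k) :=
  Primrec.fin_curry.2 ((Primrec.fin_curry₁.2 primrec_tuple_apply).comp Primrec.snd Primrec.fst)

theorem ArithmeticalFun.tupleCode (k : ℕ) :
    ArithmeticalFun (ConstructiveTruth.tupleCode (k := k)) := by
  induction k with
  | zero => exact zero
  | succ k ih => exact ih.weaken.pair last

/-- A recursive relation is arithmetical. -/
theorem Arithmetical.of_computablePred {k : ℕ} {D : (Fin k → ℕ) → Prop} (h : ComputablePred D) :
    Arithmetical D := by
  classical
  have : Computable fun n => if D (tuple k n) then 1 else 0 :=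
    (Computable.cond (h.decide.comp (primrec_tuple k).to_comp) (Computable.const 1)
      (Computable.const 0)).of_eq fun n => by simp [Bool.cond_decide]
  refine (rel₂ (R := fun x y => y ∈ (Part.some (if D (tuple k x) then 1 else 0) : Part ℕ))
    (Arithmetical.of_partrec (Partrec.nat_iff.1 this)) (ArithmeticalFun.tupleCode k)
    ArithmeticalFun.one).of_iff fun e => ?_
  rw [tuple_tupleCode]
  by_cases he : D e <;> simp [he]

/-- A recursive relation is defined by a constructively decidable formula. -/
theorem exists_decidable_defines {k : ℕ} {D : (Fin k → ℕ) → Prop} (h : ComputablePred D) :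
    ∃ φ : Formula k, φ.Decidable ∧ φ.Defines D := by
  obtain ⟨φ, hφ⟩ := Arithmetical.of_computablePred h
  exact ⟨.neg (.neg φ), Formula.decidable_neg_neg (h.of_eq fun e => (hφ e).symm),
    fun e => not_not.trans (hφ e)⟩

/-! ## Boolean combinations -/

/-- Pairing dominates its arguments, so every atom occurring in `b` has a number at most `b.code`.
-/
theorem BoolComb.eval_congr (b : BoolComb) : ∀ {v w : ℕ → Prop},
    (∀ i ≤ b.code, v i ↔ w i) → (b.Eval v ↔ b.Eval w) := by
  induction b with
  | atom i => exact fun h => h i (Nat.right_le_pair _ _)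
  | neg b ih =>
    exact fun h => not_congr (ih fun i hi => h i (hi.trans (Nat.right_le_pair _ _)))
  | and b c ihb ihc =>
    exact fun h => and_congr
      (ihb fun i hi => h i ((hi.trans (Nat.left_le_pair _ _)).trans (Nat.right_le_pair _ _)))
      (ihc fun i hi => h i ((hi.trans (Nat.right_le_pair _ _)).trans (Nat.right_le_pair _ _)))
  | or b c ihb ihc =>
    exact fun h => or_congr
      (ihb fun i hi => h i ((hi.trans (Nat.left_le_pair _ _)).trans (Nat.right_le_pair _ _)))
      (ihc fun i hi => h i ((hi.trans (Nat.right_le_pair _ _)).trans (Nat.right_le_pair _ _)))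

/-- Apply a connective, given by the tag used in `BoolComb.code`, to optional truth values. -/
def applyTag (n : ℕ) (x y z : Option Bool) : Option Bool :=
  if n = 1 then x.map Bool.not
  else if n = 2 then y.bind fun a => z.map (a && ·)
  else if n = 3 then y.bind fun a => z.map (a || ·)
  else none

/-- One step of the evaluation of codes of Boolean combinations, given the list of the values of
all smaller codes. -/
def evalStep (u : ℕ) (L : List (Option Bool)) : Option Bool :=
  if L.length.unpair.1 = 0 then some (u.testBit L.length.unpair.2)
  else applyTag L.length.unpair.1 (L.getD L.length.unpair.2 none)
    (L.getD L.length.unpair.2.unpair.1 none) (L.getD L.length.unpair.2.unpair.2 none)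

/-- The values of the codes below `n` under the valuation given by the binary digits of `u`. -/
def evalList (u : ℕ) : ℕ → List (Option Bool)
  | 0 => []
  | n + 1 => evalList u n ++ [evalStep u (evalList u n)]

/-- The value of the Boolean combination coded by `c`, if any, under the valuation given by the
binary digits of `u`. -/
def evalCode (u c : ℕ) : Option Bool := evalStep u (evalList u c)

theorem length_evalList (u n : ℕ) : (evalList u n).length = n := by
  induction n <;> simp_all [evalList]

theorem evalList_getD (u : ℕ) {m n : ℕ} (h : m < n) :
    (evalList u n).getD m none = evalCode u m := by
  induction n with
  | zero => omega
  | succ n ih =>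
    rw [evalList]
    rcases Nat.lt_succ_iff_lt_or_eq.1 h with h | rfl
    · rw [List.getD_append _ _ _ _ (by rwa [length_evalList]), ih h]
    · rw [List.getD_append_right _ _ _ _ (by rw [length_evalList]), length_evalList]
      simp [evalCode]

/-- For a nonzero tag, the second component is smaller than `c`, and so are its own components;
hence the list of values below `c` contains all that the step consults. Tag `0` consults no earlier
value. -/
theorem evalCode_eq (u c : ℕ) : evalCode u c =
    if c.unpair.1 = 0 then some (u.testBit c.unpair.2)
    else applyTag c.unpair.1 (evalCode u c.unpair.2)
      (evalCode u c.unpair.2.unpair.1) (evalCode u c.unpair.2.unpair.2) := by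
  conv_lhs => rw [evalCode, evalStep, length_evalList]
  split_ifs with h
  · rfl
  · have h1 : c.unpair.2 < c := by
      have h2 := Nat.pair_unpair c
      have h3 := Nat.add_le_pair c.unpair.1 c.unpair.2
      omega
    rw [evalList_getD u h1, evalList_getD u ((Nat.unpair_left_le _).trans_lt h1),
      evalList_getD u ((Nat.unpair_right_le _).trans_lt h1)]

theorem exists_evalCode_code (u : ℕ) (b : BoolComb) :
    ∃ x, evalCode u b.code = some x ∧ (x = true ↔ b.Eval fun i => u.testBit i = true) := by
  induction b with
  | atom i => rw [evalCode_eq]; simp [BoolComb.code, BoolComb.Eval]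
  | neg b ih =>
    obtain ⟨x, hx, h⟩ := ih
    rw [evalCode_eq]; simp [BoolComb.code, BoolComb.Eval, applyTag, hx, ← h]
  | and b c ihb ihc =>
    obtain ⟨x, hx, h⟩ := ihb
    obtain ⟨y, hy, h'⟩ := ihc
    rw [evalCode_eq]; simp [BoolComb.code, BoolComb.Eval, applyTag, hx, hy, ← h, ← h']
  | or b c ihb ihc =>
    obtain ⟨x, hx, h⟩ := ihb
    obtain ⟨y, hy, h'⟩ := ihc
    rw [evalCode_eq]; simp [BoolComb.code, BoolComb.Eval, applyTag, hx, hy, ← h, ← h']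

theorem evalCode_code_eq_false (u : ℕ) (b : BoolComb) :
    evalCode u b.code = some false ↔ ¬ b.Eval fun i => u.testBit i = true := by
  obtain ⟨x, hx, h⟩ := exists_evalCode_code u b
  rw [hx, ← h]
  simp

/-- The evaluation doubles as a syntax check: a number that codes no combination gets the value
`none`. -/
theorem exists_code_of_evalCode {u c : ℕ} {x : Bool} (h : evalCode u c = some x) :
    ∃ b : BoolComb, b.code = c := by
  induction c using Nat.strong_induction_on generalizing x with
  | _ c ih =>
    rw [evalCode_eq] at h
    have hc := Nat.pair_unpair c
    have h3 := Nat.add_le_pair c.unpair.1 c.unpair.2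
    have hl := Nat.unpair_left_le c.unpair.2
    have hr := Nat.unpair_right_le c.unpair.2
    unfold applyTag at h
    split_ifs at h with h0 h1 h2 h4
    · exact ⟨.atom c.unpair.2, by rw [BoolComb.code, ← h0, hc]⟩
    · obtain ⟨y, hy, _⟩ := Option.map_eq_some_iff.1 h
      obtain ⟨b, hb⟩ := ih _ (by omega) hy
      exact ⟨.neg b, by rw [BoolComb.code, hb, ← h1, hc]⟩
    · obtain ⟨y, hy, h⟩ := Option.bind_eq_some_iff.1 h
      obtain ⟨z, hz, _⟩ := Option.map_eq_some_iff.1 h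
      obtain ⟨b, hb⟩ := ih _ (by omega) hy
      obtain ⟨d, hd⟩ := ih _ (by omega) hz
      exact ⟨.and b d, by rw [BoolComb.code, hb, hd, Nat.pair_unpair, ← h2, hc]⟩
    · obtain ⟨y, hy, h⟩ := Option.bind_eq_some_iff.1 h
      obtain ⟨z, hz, _⟩ := Option.map_eq_some_iff.1 h
      obtain ⟨b, hb⟩ := ih _ (by omega) hy
      obtain ⟨d, hd⟩ := ih _ (by omega) hz
      exact ⟨.or b d, by rw [BoolComb.code, hb, hd, Nat.pair_unpair, ← h4, hc]⟩

theorem exists_lt_testBit_iff (v : ℕ → Prop) (n : ℕ) :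
    ∃ u < 2 ^ n, ∀ i < n, (u.testBit i = true ↔ v i) := by
  classical
  refine ⟨Nat.ofBits fun i : Fin n => decide (v i), Nat.ofBits_lt_two_pow _, fun i hi => ?_⟩
  rw [Nat.testBit_ofBits_lt _ _ hi]
  simp

/-- The atoms are at most `c`, so valuations with `c + 1` binary digits suffice. The bounded search
makes the property primitive recursive. -/
theorem not_tautological_iff (c : ℕ) : (∃ b : BoolComb, b.code = c ∧ ¬ b.Tautological) ↔
    ∃ u < 2 ^ (c + 1), evalCode u c = some false := by
  constructor
  · rintro ⟨b, rfl, hb⟩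
    obtain ⟨v, hv⟩ := not_forall.1 hb
    obtain ⟨u, hu, h⟩ := exists_lt_testBit_iff v (b.code + 1)
    refine ⟨u, hu, ?_⟩
    rwa [evalCode_code_eq_false, b.eval_congr fun i hi => h i (Nat.lt_succ_of_le hi)]
  · rintro ⟨u, _, h⟩
    obtain ⟨b, rfl⟩ := exists_code_of_evalCode h
    refine ⟨b, rfl, fun hb => ?_⟩
    exact (evalCode_code_eq_false u b).1 h (hb _)

/-- The valuation need not be recursive, but only its finite part up to `c` matters, and that is
coded by a number `u`. This makes falsity arithmetical when `v` is. -/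
theorem eval_false_iff (c : ℕ) (v : ℕ → Prop) :
    (∃ b : BoolComb, b.code = c ∧ ¬ b.Eval v) ↔
      ∃ u, (∀ i, i < c + 1 → (u.testBit i = true ↔ v i)) ∧ evalCode u c = some false := by
  constructor
  · rintro ⟨b, rfl, hb⟩
    obtain ⟨u, -, h⟩ := exists_lt_testBit_iff v (b.code + 1)
    refine ⟨u, h, ?_⟩
    rwa [evalCode_code_eq_false, b.eval_congr fun i hi => h i (Nat.lt_succ_of_le hi)]
  · rintro ⟨u, hu, h⟩
    obtain ⟨b, rfl⟩ := exists_code_of_evalCode h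
    refine ⟨b, rfl, ?_⟩
    rwa [evalCode_code_eq_false, b.eval_congr fun i hi => hu i (Nat.lt_succ_of_le hi)] at h

theorem primrec_pow_two : Primrec fun n => 2 ^ n :=
  (Primrec.nat_rec₁ (f := fun _ x => 2 * x) 1 ((Primrec.nat_double.comp Primrec.snd).to₂)).of_eq
    fun n => by induction n <;> simp_all [pow_succ, mul_comm]

theorem primrec_testBit : Primrec₂ Nat.testBit := by
  have : Primrec₂ fun u i : ℕ => decide (u / 2 ^ i % 2 = 1) :=
    (PrimrecPred.decide (Primrec.eq.comp (Primrec.nat_mod.comp (Primrec.nat_div.comp Primrec.fst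
      (primrec_pow_two.comp Primrec.snd)) (Primrec.const 2)) (Primrec.const 1)))
  exact this.of_eq fun u i => by rw [Nat.testBit_eq_decide_div_mod_eq]

theorem primrec_evalCode : Primrec₂ evalCode := by
  have hlen : Primrec fun x : ℕ × List (Option Bool) => x.2.length :=
    Primrec.list_length.comp Primrec.snd
  have h1 := Primrec.fst.comp (Primrec.unpair.comp hlen)
  have h2 := Primrec.snd.comp (Primrec.unpair.comp hlen)
  have get {f : ℕ × List (Option Bool) → ℕ} (hf : Primrec f) :
      Primrec fun x : ℕ × List (Option Bool) => x.2.getD (f x) none := (Primrec.list_getD none).comp Primrec.snd hf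
  have hstep : Primrec₂ evalStep := by
    refine Primrec.ite (Primrec.eq.comp h1 (Primrec.const 0))
      (Primrec.option_some.comp (primrec_testBit.comp Primrec.fst h2)) ?_
    have e1 := get h2
    have e2 := get (Primrec.fst.comp (Primrec.unpair.comp h2))
    have e3 := get (Primrec.snd.comp (Primrec.unpair.comp h2))
    refine Primrec.ite (Primrec.eq.comp h1 (Primrec.const 1))
      ((Primrec.dom_finite fun x : Option Bool => x.map Bool.not).comp e1) ?_
    refine Primrec.ite (Primrec.eq.comp h1 (Primrec.const 2))
      ((Primrec.dom_finite fun x : Option Bool × Option Bool =>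
        x.1.bind fun a => x.2.map (a && ·)).comp (e2.pair e3)) ?_
    exact Primrec.ite (Primrec.eq.comp h1 (Primrec.const 3))
      ((Primrec.dom_finite fun x : Option Bool × Option Bool =>
        x.1.bind fun a => x.2.map (a || ·)).comp (e2.pair e3)) (Primrec.const none)
  have hlist : Primrec₂ evalList := by
    refine (Primrec.nat_rec (f := fun _ : ℕ => ([] : List (Option Bool)))
      (g := fun u (x : ℕ × List (Option Bool)) => x.2 ++ [evalStep u x.2]) (Primrec.const [])
      (Primrec.list_concat.comp (Primrec.snd.comp Primrec.snd)
        (hstep.comp Primrec.fst (Primrec.snd.comp Primrec.snd)))).of_eq fun u n => ?_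
    induction n with
    | zero => rfl
    | succ n ih => rw [evalList, ← ih]
  exact hstep.comp Primrec.fst hlist

/-- `u` is the least number whose binary digits falsify the combination coded by `c`. -/
def LeastFalsifier (c u : ℕ) : Prop :=
  evalCode u c = some false ∧ ∀ w < u, evalCode w c ≠ some false

theorem exists_leastFalsifier {b : BoolComb} (h : ¬ b.Tautological) :
    ∃ u, LeastFalsifier b.code u := by
  classical
  have h' : ∃ u, evalCode u b.code = some false := by
    obtain ⟨u, _, hu⟩ := (not_tautological_iff b.code).1 ⟨b, rfl, h⟩
    exact ⟨u, hu⟩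
  exact ⟨Nat.find h', Nat.find_spec h', fun w hw => Nat.find_min h' hw⟩

theorem LeastFalsifier.unique {c u w : ℕ} (hu : LeastFalsifier c u) (hw : LeastFalsifier c w) :
    u = w := by
  rcases lt_trichotomy u w with h | h | h
  · exact (hw.2 u h hu.1).elim
  · exact h
  · exact (hu.2 w h hw.1).elim

theorem LeastFalsifier.not_eval {b : BoolComb} {u : ℕ} (h : LeastFalsifier b.code u) :
    ¬ b.Eval fun i => u.testBit i = true :=
  (evalCode_code_eq_false u b).1 h.1

theorem primrecRel_leastFalsifier : PrimrecRel LeastFalsifier := by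
  have h : PrimrecRel fun (u c : ℕ) => evalCode u c = some false :=
    Primrec.eq.comp primrec_evalCode (Primrec.const (some false))
  exact (h.comp Primrec.snd Primrec.fst).and
    ((PrimrecRel.forall_lt h.not).comp Primrec.snd Primrec.fst)

theorem computablePred_nontaut :
    ComputablePred fun e : Fin 1 → ℕ => ∃ b : BoolComb, b.code = e 0 ∧ ¬ b.Tautological := by
  have h : PrimrecRel fun (u c : ℕ) => evalCode u c = some false :=
    Primrec.eq.comp primrec_evalCode (Primrec.const (some false))
  have h0 : Primrec fun e : Fin 1 → ℕ => e 0 := Primrec.fin_app.comp Primrec.id (Primrec.const 0)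
  exact ((PrimrecRel.exists_lt h).comp (primrec_pow_two.comp (Primrec.succ.comp h0)) h0
    |>.computablePred).of_eq fun e => (not_tautological_iff _).symm

theorem arithmetical_isFalse {R : ℕ → ℕ → Prop}
    (hR : Arithmetical fun e : Fin 2 → ℕ => R (e 0) (e 1)) :
    Arithmetical fun e : Fin 2 → ℕ => ∃ b : BoolComb, b.code = e 0 ∧ ¬ b.Eval fun i => R (e 1) i := by
  have h1 : ComputablePred fun e : Fin 2 → ℕ => (e 0).testBit (e 1) = true :=
    (Primrec.eq.comp (primrec_testBit.comp (Primrec.fin_app.comp Primrec.id (Primrec.const 0))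
      (Primrec.fin_app.comp Primrec.id (Primrec.const 1))) (Primrec.const true)).computablePred
  have h2 : ComputablePred fun e : Fin 2 → ℕ => evalCode (e 0) (e 1) = some false :=
    (Primrec.eq.comp (primrec_evalCode.comp (Primrec.fin_app.comp Primrec.id (Primrec.const 0))
      (Primrec.fin_app.comp Primrec.id (Primrec.const 1)))
      (Primrec.const (some false))).computablePred
  open ArithmeticalFun in
  refine (Arithmetical.ex (P := fun e u => (∀ i, i < e 0 + 1 → (u.testBit i = true ↔ R (e 1) i)) ∧
    evalCode u (e 0) = some false) (Arithmetical.and (Arithmetical.all ?_) ?_)).of_iff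
    fun e => eval_false_iff _ _
  · exact (Arithmetical.lt (var 3) ((var 0).add one)).imp
      ((Arithmetical.rel₂ (R := fun u i => Nat.testBit u i = true) (.of_computablePred h1)
        (var 2) (var 3)).iff (Arithmetical.rel₂ hR (var 1) (var 3)))
  · exact Arithmetical.rel₂ (R := fun u i => evalCode u i = some false) (.of_computablePred h2)
        (var 2) (var 0)

/-! ## Existence of presentations -/

theorem encode_eq_and_iff {p : List ℕ → Prop} (n : ℕ) :
    (∃ s : List ℕ, Encodable.encode s = n ∧ p s) ↔ p (Denumerable.ofNat (List ℕ) n) := by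
  constructor
  · rintro ⟨s, rfl, h⟩
    rwa [Denumerable.ofNat_encode]
  · exact fun h => ⟨_, Denumerable.encode_ofNat n, h⟩

theorem Primrec.finApp {k : ℕ} (i : Fin k) : Primrec fun e : Fin k → ℕ => e i :=
  Primrec.fin_app.comp Primrec.id (Primrec.const i)

theorem computablePred_len : ComputablePred fun e : Fin 2 → ℕ =>
    ∃ s : List ℕ, Encodable.encode s = e 0 ∧ s.length = e 1 :=
  (Primrec.eq.comp (Primrec.list_length.comp ((Primrec.ofNat (List ℕ)).comp (Primrec.finApp 0)))
    (Primrec.finApp 1)).computablePred.of_eq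
    fun e => (encode_eq_and_iff (p := fun s => s.length = e 1) (e 0)).symm

theorem primrecRel_isPrefix : PrimrecRel fun s t : List ℕ => s <+: t :=
  (Primrec.eq.comp (Primrec.list_take.comp (Primrec.list_length.comp Primrec.fst) Primrec.snd)
    Primrec.fst).of_eq fun x => by
      beta_reduce; rw [List.prefix_iff_eq_take, eq_comm]

theorem primrecRel_incompatible : PrimrecRel Incompatible :=
  (primrecRel_isPrefix.not.and (primrecRel_isPrefix.comp Primrec.snd Primrec.fst).not)

theorem computablePred_incomp : ComputablePred fun e : Fin 2 → ℕ =>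
    ∃ s t : List ℕ, Encodable.encode s = e 0 ∧ Encodable.encode t = e 1 ∧ Incompatible s t := by
  refine (primrecRel_incompatible.comp ((Primrec.ofNat (List ℕ)).comp (Primrec.finApp 0))
    ((Primrec.ofNat (List ℕ)).comp (Primrec.finApp 1))).computablePred.of_eq fun e => ?_
  constructor
  · exact fun h => ⟨_, _, Denumerable.encode_ofNat _, Denumerable.encode_ofNat _, h⟩
  · rintro ⟨s, t, hs, ht, h⟩
    rwa [← hs, ← ht, Denumerable.ofNat_encode, Denumerable.ofNat_encode]

/-- The computation with program and input `e 0, e 1` does not halt within `e 2` steps. -/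
def NotHaltedWithin (e : Fin 3 → ℕ) : Prop :=
  Nat.Partrec.Code.evaln (e 2) (Denumerable.ofNat Nat.Partrec.Code (e 0)) (e 1) = none

theorem primrecPred_notHaltedWithin : PrimrecPred NotHaltedWithin :=
  Primrec.eq.comp (Nat.Partrec.Code.primrec_evaln.comp (Primrec.pair (Primrec.pair
    (Primrec.finApp 2) ((Primrec.ofNat _).comp (Primrec.finApp 0))) (Primrec.finApp 1)))
    (Primrec.const none)

/-- Here `R(n, m)` says that program `n` does not halt on input `m`. The indices for a family `Q`
come from currying a program that semidecides the complement of `Q`. -/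
theorem isUniversalPi01_of_defines {δ : Formula 3} (hδ : δ.Defines NotHaltedWithin) :
    IsUniversalPi01 fun n m => (Formula.all δ).Holds ![n, m] := by
  have holds (n m : ℕ) : (Formula.all δ).Holds ![n, m] ↔ ∀ z, Nat.Partrec.Code.evaln z
      (Denumerable.ofNat Nat.Partrec.Code n) m = none :=
    forall_congr' fun z => hδ (Fin.snoc ![n, m] z)
  constructor
  · refine REPred.of_exists_computable (g := fun p z => (Nat.Partrec.Code.evaln z
      (Denumerable.ofNat Nat.Partrec.Code p.1) p.2).isSome) (Primrec.to_comp ?_) fun p => ?_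
    · exact Primrec.option_isSome.comp (Nat.Partrec.Code.primrec_evaln.comp
        (Primrec.pair (Primrec.pair Primrec.snd ((Primrec.ofNat _).comp
        (Primrec.fst.comp Primrec.fst))) (Primrec.snd.comp Primrec.fst)))
    · beta_reduce
      rw [holds, not_forall]
      exact exists_congr fun z => Option.isSome_iff_ne_none.symm
  · intro Q hQ
    obtain ⟨c, hc⟩ := Nat.Partrec.Code.exists_code.1 hQ
    refine ⟨fun a => Encodable.encode (c.curry a), (Primrec.encode.comp
      (Nat.Partrec.Code.primrec₂_curry.comp (Primrec.const c) Primrec.id)).to_comp, fun a m => ?_⟩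
    beta_reduce
    rw [holds]
    have : ¬ Q a m ↔ (c.eval (Encodable.encode (a, m))).Dom := by
      rw [hc]; simp [Part.assert]
    rw [← not_iff_not, this, not_forall, Encodable.encode_prod_val, Part.dom_iff_mem]
    simp only [Encodable.encode_nat, Denumerable.ofNat_encode, ← Nat.Partrec.Code.eval_curry,
      Nat.Partrec.Code.evaln_complete]
    rw [exists_comm]
    exact exists_congr fun z => by rw [← ne_eq, Option.ne_none_iff_exists']; rfl

/-- The numeral of `a`. -/
def numeral (k : ℕ) : ℕ → Term k
  | 0 => .zero
  | a + 1 => .add (numeral k a) .one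

/-- The Gödel number of the numeral of `a`. -/
def numeralCode : ℕ → ℕ
  | 0 => Nat.pair 1 0
  | a + 1 => Nat.pair 3 (Nat.pair (numeralCode a) (Nat.pair 2 0))

theorem val_numeral {k : ℕ} (e : Fin k → ℕ) (a : ℕ) : (numeral k a).val e = a := by
  induction a <;> simp_all [numeral, Term.val]

theorem rename_numeral {k m : ℕ} (f : Fin k → Fin m) (a : ℕ) :
    (numeral k a).rename f = numeral m a := by
  induction a <;> simp_all [numeral, Term.rename]

theorem code_numeral (k a : ℕ) : (numeral k a).code = numeralCode a := by
  induction a <;> simp_all [numeral, numeralCode, Term.code]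

theorem primrec_numeralCode : Primrec numeralCode := by
  refine (Primrec.nat_rec₁ (f := fun _ x => Nat.pair 3 (Nat.pair x (Nat.pair 2 0)))
    (Nat.pair 1 0) ?_).of_eq fun n => ?_
  · exact Primrec₂.natPair.comp (Primrec.const 3)
      (Primrec₂.natPair.comp Primrec.snd (Primrec.const _))
  · induction n with
    | zero => rfl
    | succ n ih => rw [numeralCode, ← ih]

/-- Substitute the numeral of `a` for the first variable, up to double negation. -/
def Formula.substNumeral (φ : Formula 2) (a : ℕ) : Formula 1 :=
  .neg (.neg (.ex (.and (.eq (.var 1) (numeral 2 a)) (φ.rename ![1, 0]))))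

theorem Formula.holds_substNumeral (φ : Formula 2) (a : ℕ) (e : Fin 1 → ℕ) :
    (φ.substNumeral a).Holds e ↔ φ.Holds ![a, e 0] := by
  have h (n : ℕ) : (Fin.snoc e n : Fin 2 → ℕ) ∘ ![1, 0] = ![n, e 0] := by
    funext i
    fin_cases i <;> rfl
  have h1 (n : ℕ) : (Fin.snoc e n : Fin 2 → ℕ) 1 = n := rfl
  simp [substNumeral, Formula.Holds, Term.val, val_numeral, Formula.holds_rename, h, h1]

/-- Only the tree formula depends on `a`, and it does so through the numeral of `a` alone. Its
double negation makes each instance constructively decidable. -/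
theorem exists_presentations {U : ℕ → Set (List ℕ)}
    (hU : ComputablePred fun x : ℕ × List ℕ => x.2 ∈ U x.1) :
    ∃ D : ∀ a, Presentation (U a), Computable fun a => (D a).statement.code := by
  obtain ⟨len, hlen, hlen'⟩ := exists_decidable_defines computablePred_len
  obtain ⟨incomp, hincomp, hincomp'⟩ := exists_decidable_defines computablePred_incomp
  obtain ⟨matrix, hmatrix, hmatrix'⟩ :=
    exists_decidable_defines primrecPred_notHaltedWithin.computablePred
  obtain ⟨nontaut, hnontaut, hnontaut'⟩ := exists_decidable_defines computablePred_nontaut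
  obtain ⟨isFalse, hisFalse⟩ := arithmetical_isFalse
    (R := fun n m => (Formula.all matrix).Holds ![n, m])
    ⟨.all matrix, fun e => iff_of_eq (congrArg _ (by funext i; fin_cases i <;> rfl))⟩
  have hU' : ComputablePred fun e : Fin 2 → ℕ => Denumerable.ofNat (List ℕ) (e 1) ∈ U (e 0) := by
    obtain ⟨f, hf, hfU⟩ := ComputablePred.computable_iff.1 hU
    refine ComputablePred.computable_iff.2 ⟨_, hf.comp (Computable.pair
      (Primrec.finApp 0).to_comp ((Primrec.ofNat (List ℕ)).comp (Primrec.finApp 1)).to_comp), ?_⟩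
    funext e
    exact congrFun hfU (e 0, Denumerable.ofNat (List ℕ) (e 1))
  obtain ⟨tree, -, htree⟩ := exists_decidable_defines hU'
  have holds_tree (a : ℕ) (e : Fin 1 → ℕ) : (tree.substNumeral a).Holds e ↔
      Denumerable.ofNat (List ℕ) (e 0) ∈ U a :=
    (tree.holds_substNumeral a e).trans (htree _)
  have tree_decidable (a : ℕ) : (tree.substNumeral a).Decidable := by
    refine Formula.decidable_neg_neg ?_
    obtain ⟨f, hf, hfU⟩ := ComputablePred.computable_iff.1 hU
    refine ComputablePred.computable_iff.2 ⟨_, hf.comp (Computable.pair (Computable.const a)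
      ((Primrec.ofNat (List ℕ)).comp (Primrec.finApp 0)).to_comp), ?_⟩
    funext e
    refine propext ((not_not.symm.trans (holds_tree a e)).trans ?_)
    exact iff_of_eq (congrFun hfU (a, Denumerable.ofNat (List ℕ) (e 0)))
  refine ⟨fun a =>
    { len, incomp, matrix, nontaut, isFalse
      tree := tree.substNumeral a
      len_decidable := hlen
      len_defines := hlen'
      tree_decidable := tree_decidable a
      tree_defines := fun e => (holds_tree a e).trans
        (encode_eq_and_iff (p := fun s => s ∈ U a) (e 0)).symm
      incomp_decidable := hincomp
      incomp_defines := hincomp'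
      matrix_decidable := hmatrix
      matrix_universal := isUniversalPi01_of_defines hmatrix'
      nontaut_decidable := hnontaut
      nontaut_defines := hnontaut'
      isFalse_defines := hisFalse }, ?_⟩
  -- After unfolding, the Gödel number is a fixed expression in pairings, constants and `numeralCode
  -- a`.
  simp only [Presentation.statement, Presentation.branch, Presentation.split,
    Presentation.combination, Presentation.dec, Formula.substNumeral, Formula.rename,
    Formula.code, Term.rename, rename_numeral, code_numeral, Term.code]
  have pair {f g : ℕ → ℕ} (hf : Computable f) (hg : Computable g) :
      Computable fun a => Nat.pair (f a) (g a) := Primrec₂.natPair.to_comp.comp hf hg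
  repeat first
    | with_reducible exact Computable.const _
    | with_reducible exact primrec_numeralCode.to_comp
    | with_reducible refine pair ?_ ?_

/-! ## Searching through an infinite sequence -/

/-- The first value of `f` below `n`. -/
def firstHit {γ : Type} (f : ℕ → Option γ) : ℕ → Option γ
  | 0 => none
  | n + 1 => firstHit f n <|> f n

theorem firstHit_congr {γ : Type} {f g : ℕ → Option γ} {n : ℕ} (h : ∀ i < n, f i = g i) :
    firstHit f n = firstHit g n := by
  induction n with
  | zero => rfl
  | succ n ih => rw [firstHit, firstHit, ih fun i hi => h i (by omega), h n (by omega)]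

theorem firstHit_mono {γ : Type} {f : ℕ → Option γ} {m n : ℕ} {y : γ} (h : firstHit f m = some y)
    (hmn : m ≤ n) : firstHit f n = some y := by
  induction n, hmn using Nat.le_induction with
  | base => exact h
  | succ n _ ih => rw [firstHit, ih]; rfl

theorem firstHit_eq_some {γ : Type} {f : ℕ → Option γ} {n : ℕ} {y : γ}
    (h : firstHit f n = some y) : ∃ i, f i = some y := by
  induction n with
  | zero => cases h
  | succ n ih =>
    rw [firstHit] at h
    cases h' : firstHit f n with
    | none => rw [h'] at h; exact ⟨n, h⟩
    | some x => rw [h'] at h; exact ih (h'.trans h)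

theorem exists_firstHit {γ : Type} {f : ℕ → Option γ} {i : ℕ} {y : γ} (h : f i = some y) :
    ∃ z, firstHit f (i + 1) = some z := by
  cases h' : firstHit f i with
  | none => exact ⟨y, by rw [firstHit, h', h]; rfl⟩
  | some x => exact ⟨x, by rw [firstHit, h']; rfl⟩

/-- Apply `H` to two entries of a sequence and a parameter, all selected by `i`. -/
def hit {γ : Type} (H : List ℕ → List ℕ → ℕ → Option γ) (X : ℕ → Option (List ℕ)) (i : ℕ) :
    Option γ :=
  (X i.unpair.1).bind fun p => (X i.unpair.2.unpair.1).bind fun q => H p q i.unpair.2.unpair.2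

/-- The first value of `H` found in a finite sequence. -/
def search {γ : Type} (H : List ℕ → List ℕ → ℕ → Option γ) (σ : List (Option (List ℕ))) :
    Option γ :=
  firstHit (hit H fun j => σ.getD j none) σ.length

theorem getD_segment {α : Type} (f : ℕ → α) (d : α) {i l : ℕ} (h : i < l) :
    (segment f l).getD i d = f i := by
  simp [segment, h]

theorem length_segment {α : Type} (f : ℕ → α) (l : ℕ) : (segment f l).length = l := by
  simp [segment]

/-- An index bounds its unpaired components, so attempts below `l` consult only entries below `l`;
the default `none` is never read. -/
theorem search_segment {γ : Type} (H : List ℕ → List ℕ → ℕ → Option γ) (X : Candidate) (l : ℕ) :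
    search H (segment X l) = firstHit (hit H X) l := by
  rw [search, length_segment]
  refine firstHit_congr fun i hi => ?_
  have h1 := Nat.unpair_left_le i
  have h2 := Nat.unpair_right_le i
  have h3 := Nat.unpair_left_le i.unpair.2
  rw [hit, hit, getD_segment X none (by omega), getD_segment X none (by omega)]

/-- Lengthening the segment never changes the first hit. So all segments on which the search
succeeds agree on one value, as `pairs_app_respond` requires. -/
theorem search_spec {γ : Type} {H : List ℕ → List ℕ → ℕ → Option γ} {X : Candidate}
    (h : ∃ p ∈ X.pairs, ∃ q ∈ X.pairs, ∃ d y, H p q d = some y) :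
    ∃ y, (∃ p ∈ X.pairs, ∃ q ∈ X.pairs, ∃ d, H p q d = some y) ∧
      (∃ l, search H (segment X l) = some y) ∧
      ∀ l z, search H (segment X l) = some z → z = y := by
  simp only [search_segment]
  obtain ⟨p, ⟨i, hi⟩, q, ⟨j, hj⟩, d, y, hy⟩ := h
  obtain ⟨z, hz⟩ := exists_firstHit (f := hit H X) (i := Nat.pair i (Nat.pair j d)) (y := y)
    (by simp [hit, hi, hj, hy])
  refine ⟨z, ?_, ⟨_, hz⟩, fun l w hw => ?_⟩
  · obtain ⟨i, hi⟩ := firstHit_eq_some hz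
    obtain ⟨p, hp, hi⟩ := Option.bind_eq_some_iff.1 hi
    obtain ⟨q, hq, hi⟩ := Option.bind_eq_some_iff.1 hi
    exact ⟨p, ⟨_, hp⟩, q, ⟨_, hq⟩, _, hi⟩
  · have h1 := firstHit_mono hw (le_max_left l (Nat.pair i (Nat.pair j d) + 1))
    have h2 := firstHit_mono hz (le_max_right l (Nat.pair i (Nat.pair j d) + 1))
    exact Option.some_inj.1 (h1.symm.trans h2)

section Primrec

variable {α γ : Type} [Primcodable α] [Primcodable γ]

theorem primrec_search {H : α → List ℕ → List ℕ → ℕ → Option γ}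
    (hH : Primrec fun x : ((α × List ℕ) × List ℕ) × ℕ => H x.1.1.1 x.1.1.2 x.1.2 x.2) :
    Primrec₂ fun a => search (H a) := by
  have hhit : Primrec₂ fun (x : α × List (Option (List ℕ))) i =>
      hit (H x.1) (fun j => x.2.getD j none) i := by
    have u1 : Primrec fun x : (α × List (Option (List ℕ))) × ℕ => x.2.unpair.1 :=
      Primrec.fst.comp (Primrec.unpair.comp Primrec.snd)
    have u2 : Primrec fun x : (α × List (Option (List ℕ))) × ℕ => x.2.unpair.2 :=
      Primrec.snd.comp (Primrec.unpair.comp Primrec.snd)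
    have get {f : (α × List (Option (List ℕ))) × ℕ → ℕ} (hf : Primrec f) :
        Primrec fun x : (α × List (Option (List ℕ))) × ℕ => x.1.2.getD (f x) none :=
      (Primrec.list_getD none).comp (Primrec.snd.comp Primrec.fst) hf
    have hH' : Primrec fun x : (((α × List (Option (List ℕ))) × ℕ) × List ℕ) × List ℕ =>
        H x.1.1.1.1 x.1.2 x.2 x.1.1.2.unpair.2.unpair.2 :=
      hH.comp (Primrec.pair (Primrec.pair (Primrec.pair
        (Primrec.fst.comp (Primrec.fst.comp (Primrec.fst.comp Primrec.fst)))
        (Primrec.snd.comp Primrec.fst)) Primrec.snd)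
        ((Primrec.snd.comp (Primrec.unpair.comp u2)).comp (Primrec.fst.comp Primrec.fst)))
    exact Primrec.option_bind (get u1) (Primrec.option_bind
      ((get (Primrec.fst.comp (Primrec.unpair.comp u2))).comp Primrec.fst) hH'.to₂).to₂
  have : Primrec₂ fun (x : α × List (Option (List ℕ))) n =>
      firstHit (hit (H x.1) (fun j => x.2.getD j none)) n := by
    refine (Primrec.nat_rec (f := fun _ => (none : Option γ))
      (g := fun (x : α × List (Option (List ℕ))) (y : ℕ × Option γ) =>
        y.2 <|> hit (H x.1) (fun j => x.2.getD j none) y.1) (Primrec.const none)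
      (Primrec.option_orElse.comp (Primrec.snd.comp Primrec.snd)
        (hhit.comp Primrec.fst (Primrec.fst.comp Primrec.snd)))).of_eq fun x n => ?_
    induction n with
    | zero => rfl
    | succ n ih => rw [firstHit, ← ih]
  exact this.comp Primrec.id (Primrec.list_length.comp Primrec.snd)

theorem primrec_segment {X : α → ℕ → γ} (hX : Primrec₂ X) :
    Primrec₂ fun a l => segment (X a) l :=
  Primrec.list_map (Primrec.list_range.comp Primrec.snd)
    (hX.comp (Primrec.fst.comp Primrec.fst) Primrec.snd)

end Primrec

/-! ## Witnesses for the parts of the uniform implication -/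

/-- Decide `R(n, m)` as told by `b`, given witnesses `V` for the matrix of `R`. -/
def decWitness (V : List ℕ → Candidate) (n m b : ℕ) : Candidate :=
  if b = 0 then Candidate.out 0 (Candidate.tabulate fun z => V [n, m, z])
  else Candidate.out 1 fun _ => none

theorem primrec_list_pair {α : Type} [Primcodable α] {f g : α → ℕ} (hf : Primrec f)
    (hg : Primrec g) : Primrec fun a => [f a, g a] :=
  Primrec.list_cons.comp hf (Primrec.list_cons.comp hg (Primrec.const []))

theorem primrec_decWitness {α : Type} [Primcodable α] {V : List ℕ → Candidate} (hV : Primrec₂ V)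
    {n m b : α → ℕ} (hn : Primrec n) (hm : Primrec m) (hb : Primrec b) :
    Primrec₂ fun a => decWitness V (n a) (m a) (b a) := by
  have hlist : Primrec fun x : (α × ℕ) × ℕ => [n x.1.1, m x.1.1, x.1.2] :=
    Primrec.list_cons.comp (hn.comp (Primrec.fst.comp Primrec.fst))
      (primrec_list_pair (hm.comp (Primrec.fst.comp Primrec.fst)) (Primrec.snd.comp Primrec.fst))
  have h0 : Primrec₂ fun a => Candidate.out 0 (Candidate.tabulate fun z => V [n a, m a, z]) :=
    Candidate.primrec_out (Primrec.const 0)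
      (Candidate.primrec_tabulate (W := fun a z => V [n a, m a, z]) (hV.comp hlist Primrec.snd))
  have h1 : Primrec₂ fun _ : α => Candidate.out 1 fun _ => none :=
    Candidate.primrec_out (Primrec.const 1) (Primrec.const none).to₂
  refine Primrec.of_eq (Primrec.ite (Primrec.eq.comp (hb.comp Primrec.fst) (Primrec.const 0))
    h0 h1) fun x => ?_
  beta_reduce
  unfold decWitness
  split_ifs <;> rfl

namespace Presentation

variable {T : Set (List ℕ)} (D : Presentation T)

/-- The universal `Π⁰₁` predicate of the presentation. -/
def R (n m : ℕ) : Prop := (Formula.all D.matrix).Holds ![n, m]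

theorem comp_pair {k : ℕ} (e : Fin k → ℕ) (i j : Fin k) : e ∘ ![i, j] = ![e i, e j] := by
  funext x
  fin_cases x <;> rfl

theorem comp_single {k : ℕ} (e : Fin k → ℕ) (i : Fin k) : e ∘ ![i] = ![e i] := by
  funext x
  fin_cases x; rfl

theorem witnessed_dec {V : List ℕ → Candidate}
    (hV : ∀ e : Fin 3 → ℕ, D.matrix.Holds e → D.matrix.Witnessed e (V (List.ofFn e)))
    {k : ℕ} (i j : Fin k) (e : Fin k → ℕ) {b : ℕ} (hb : D.R (e i) (e j) ↔ b = 0) :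
    (D.dec i j).Witnessed e (decWitness V (e i) (e j) b) := by
  rw [dec, Formula.witnessed_rename, comp_pair]
  by_cases h : b = 0
  · rw [decWitness, if_pos h]
    refine Or.inl ⟨Candidate.outputs_out _ _, (Candidate.witnessed_strip_out _ _ _ _).2 ?_⟩
    refine Candidate.witnessed_all_tabulate fun z => ?_
    have := hV (Fin.snoc ![e i, e j] z) (hb.2 h z)
    convert this using 2
    simp [List.ofFn_succ]
  · rw [decWitness, if_neg h]
    exact Or.inr ⟨Candidate.outputs_out _ _, fun h' => h (hb.1 h')⟩

/-- The first output names the disjunct, so `0` reports that `R` holds and `1` that it fails. -/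
theorem eq_zero_of_witnessed_dec {k : ℕ} {i j : Fin k} {e : Fin k → ℕ} {W : Candidate}
    (h : (D.dec i j).Witnessed e W) : (∃ b r, b :: r ∈ W.pairs) ∧
      ∀ b r, b :: r ∈ W.pairs → ((b = 0 ∨ b = 1) ∧ (D.R (e i) (e j) ↔ b = 0)) := by
  rw [dec, Formula.witnessed_rename, comp_pair] at h
  rcases h with ⟨ho, h⟩ | ⟨ho, h⟩ <;> rw [Candidate.outputs_iff] at ho
  · refine ⟨⟨0, ho.1⟩, fun b r hb => ?_⟩
    rw [ho.2 b r hb]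
    exact ⟨Or.inl rfl, iff_of_true h.holds rfl⟩
  · refine ⟨⟨1, ho.1⟩, fun b r hb => ?_⟩
    rw [ho.2 b r hb]
    exact ⟨Or.inr rfl, iff_of_false h one_ne_zero⟩

theorem len_holds_iff (s : List ℕ) (l : ℕ) :
    D.len.Holds ![Encodable.encode s, l] ↔ s.length = l := by
  rw [D.len_defines]
  constructor
  · rintro ⟨t, ht, h⟩
    rwa [Encodable.encode_injective ht] at h
  · exact fun h => ⟨s, rfl, h⟩

theorem tree_holds_iff (s : List ℕ) : D.tree.Holds ![Encodable.encode s] ↔ s ∈ T := by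
  rw [D.tree_defines]
  constructor
  · rintro ⟨t, ht, h⟩
    rwa [Encodable.encode_injective ht] at h
  · exact fun h => ⟨s, rfl, h⟩

/-- In these entries `l` is the input, `s` the chosen sequence, `1, 1` leads through the two
conjunctions to the decision, and `b` is its verdict. Every listed verdict is correct, so a search
may trust whatever entry it meets. -/
theorem branch_of_witnessed {e : Fin 1 → ℕ} {Y : Candidate} (h : D.branch.Witnessed e Y) :
    (∀ l, ∃ s ∈ T, s.length = l ∧ ∃ b r, l :: Encodable.encode s :: 1 :: 1 :: b :: r ∈ Y.pairs) ∧
      ∀ l s b r, l :: s :: 1 :: 1 :: b :: r ∈ Y.pairs → (D.R (e 0) s ↔ b = 0) := by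
  constructor
  · intro l
    obtain ⟨s, hs, hlen, htree, hdec⟩ := h l
    rw [Formula.witnessed_rename, comp_pair] at hlen
    obtain ⟨t, ht, htl⟩ := (D.len_defines _).1 hlen.holds
    rw [Formula.witnessed_rename, comp_single] at htree
    obtain ⟨t', ht', htT⟩ := (D.tree_defines _).1 htree.holds
    obtain rfl := Encodable.encode_injective (ht'.trans ht.symm)
    obtain ⟨b, r, hb⟩ := (D.eq_zero_of_witnessed_dec hdec).1
    refine ⟨t', htT, htl, b, r, ?_⟩
    have hts : Encodable.encode t' = s := ht
    rw [hts]
    simpa only [Candidate.mem_pairs_strip] using hb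
  · intro l s b r hp
    obtain ⟨s', hs, -, -, hdec⟩ := h l
    have : s = s' := by
      rw [Candidate.outputs_iff] at hs
      exact hs.2 s _ (Candidate.mem_pairs_strip.2 hp)
    subst this
    exact ((D.eq_zero_of_witnessed_dec hdec).2 b r
      (by simpa only [Candidate.mem_pairs_strip] using hp)).2

end Presentation

/-! ## The uniform implication fails constructively for well-founded trees -/

/-- Compatible sequences of lengths `l ≤ m` are nested, so the `s l` form a chain whose union is a
path. -/
theorem illFounded_of_compatible {T : Set (List ℕ)} {s : ℕ → List ℕ} (hs : ∀ l, (s l).length = l)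
    (hT : ∀ l, s l ∈ T) (h : ∀ l m, ¬ Incompatible (s l) (s m)) : IllFounded T := by
  have pre {l m : ℕ} (hlm : l ≤ m) : s l <+: s m := by
    by_contra h1
    refine h l m ⟨h1, fun h2 => h1 ?_⟩
    have := h2.length_le
    rw [hs, hs] at this
    rw [le_antisymm hlm this]
  refine ⟨fun l => (s (l + 1)).getD l 0, fun l => ?_⟩
  have : segment (fun l => (s (l + 1)).getD l 0) l = s l := by
    refine List.ext_getElem (by rw [length_segment, hs]) fun i h1 h2 => ?_
    rw [hs] at h2
    have h3 : i < (s (i + 1)).length := by rw [hs]; omega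
    simp only [segment, List.getElem_map, List.getElem_range]
    rw [List.getD_eq_getElem _ _ h3]
    exact (pre (Nat.succ_le_of_lt h2)).getElem h3
  rw [this]
  exact hT l

/-- `p` is an entry `l, s, 1, 1, b, …` of a witness for the hypothesis on branches, which tells the
truth value of `R(n, s)`. -/
def IsDecision (p : List ℕ) : Prop := 5 ≤ p.length ∧ p.getD 2 0 = 1 ∧ p.getD 3 0 = 1

instance : DecidablePred IsDecision := fun p => by unfold IsDecision; infer_instance

theorem IsDecision.eq_cons {p : List ℕ} (h : IsDecision p) :
    ∃ l r, p = l :: p.getD 1 0 :: 1 :: 1 :: p.getD 4 0 :: r := by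
  obtain ⟨h0, h1, h2⟩ := h
  match p, h0 with
  | l :: s :: x :: y :: b :: r, _ =>
    simp only [List.getD_cons_succ, List.getD_cons_zero] at h1 h2
    exact ⟨l, r, by simp [h1, h2]⟩

instance : DecidableRel Incompatible := fun s t => by unfold Incompatible; infer_instance

/-- Two decisions about incompatible sequences. -/
def splitHit (p q : List ℕ) (_ : ℕ) : Option ((ℕ × ℕ) × ℕ × ℕ) :=
  if (IsDecision p ∧ IsDecision q) ∧ Incompatible (Denumerable.ofNat (List ℕ) (p.getD 1 0))
      (Denumerable.ofNat (List ℕ) (q.getD 1 0))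
  then some ((p.getD 1 0, q.getD 1 0), p.getD 4 0, q.getD 4 0) else none

theorem primrec_getD (i : ℕ) : Primrec fun p : List ℕ => p.getD i 0 :=
  (Primrec.list_getD 0).comp Primrec.id (Primrec.const i)

theorem primrecPred_isDecision : PrimrecPred IsDecision :=
  (Primrec.nat_le.comp (Primrec.const 5) Primrec.list_length).and
    ((Primrec.eq.comp (primrec_getD 2) (Primrec.const 1)).and
      (Primrec.eq.comp (primrec_getD 3) (Primrec.const 1)))

theorem primrec_splitHit :
    Primrec fun x : (List ℕ × List ℕ) × ℕ => splitHit x.1.1 x.1.2 x.2 := by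
  have h1 : Primrec fun x : (List ℕ × List ℕ) × ℕ => x.1.1 := Primrec.fst.comp Primrec.fst
  have h2 : Primrec fun x : (List ℕ × List ℕ) × ℕ => x.1.2 := Primrec.snd.comp Primrec.fst
  refine Primrec.ite (((primrecPred_isDecision.comp h1).and (primrecPred_isDecision.comp h2)).and
    (primrecRel_incompatible.comp ((Primrec.ofNat (List ℕ)).comp ((primrec_getD 1).comp h1))
      ((Primrec.ofNat (List ℕ)).comp ((primrec_getD 1).comp h2))))
    (Primrec.option_some.comp ?_) (Primrec.const none)
  exact Primrec.pair (Primrec.pair ((primrec_getD 1).comp h1) ((primrec_getD 1).comp h2))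
    (Primrec.pair ((primrec_getD 4).comp h1) ((primrec_getD 4).comp h2))

/-- Indices of the universal predicate can refer to themselves. -/
theorem IsUniversalPi01.exists_fixed_point {R : ℕ → ℕ → Prop} (hR : IsUniversalPi01 R)
    {N : ℕ → ℕ → Prop} (hN : REPred fun x : ℕ × ℕ => N x.1 x.2) :
    ∃ n, ∀ m, R n m ↔ ¬ N n m := by
  obtain ⟨g, hg, hgN⟩ := REPred.exists_primrec hN
  -- Diagonalization: program `a` is run on its own code and its output is used as the index. For a
  -- program computing the translation `f` of this family, that output is the index of the resulting
  -- set itself.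
  have hQ : IsPi01 fun a m =>
      ¬ ∃ n ∈ (Denumerable.ofNat Nat.Partrec.Code a).eval a, N n m := by
    refine REPred.of_exists_computable (g := fun x t =>
      (((Denumerable.ofNat Nat.Partrec.Code x.1).evaln t.unpair.1 x.1).map
        fun n => g (n, x.2) t.unpair.2).getD false) (Primrec.to_comp ?_) fun x => ?_
    · refine Primrec.option_getD.comp (Primrec.option_map
        (Nat.Partrec.Code.primrec_evaln.comp (Primrec.pair (Primrec.pair
          (Primrec.fst.comp (Primrec.unpair.comp Primrec.snd))
          ((Primrec.ofNat _).comp (Primrec.fst.comp Primrec.fst)))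
          (Primrec.fst.comp Primrec.fst)))
        (hg.comp (Primrec.pair Primrec.snd (Primrec.snd.comp (Primrec.fst.comp Primrec.fst)))
          (Primrec.snd.comp (Primrec.unpair.comp (Primrec.snd.comp Primrec.fst)))).to₂)
        (Primrec.const false)
    · rw [not_not]
      constructor
      · rintro ⟨n, hn, h⟩
        obtain ⟨t, ht⟩ := Nat.Partrec.Code.evaln_complete.1 hn
        obtain ⟨u, hu⟩ := (hgN (n, x.2)).1 h
        refine ⟨Nat.pair t u, ?_⟩
        rw [Nat.unpair_pair, Option.mem_def.1 ht]
        exact hu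
      · rintro ⟨t, ht⟩
        cases h : (Denumerable.ofNat Nat.Partrec.Code x.1).evaln t.unpair.1 x.1 with
        | none => rw [h] at ht; simp at ht
        | some n =>
          rw [h] at ht
          exact ⟨n, Nat.Partrec.Code.evaln_sound h, (hgN (n, x.2)).2 ⟨_, ht⟩⟩
  obtain ⟨f, hf, hfR⟩ := hR.2 _ hQ
  obtain ⟨c, hc⟩ := Nat.Partrec.Code.exists_code.1 (Partrec.nat_iff.1 hf)
  refine ⟨f (Encodable.encode c), fun m => ?_⟩
  rw [← hfR, Denumerable.ofNat_encode, hc]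
  simp

namespace Presentation

variable {T : Set (List ℕ)} (D : Presentation T)

/-- Output incompatible sequences `s` and `t`, together with decisions about them. -/
def splitWitness (Vi Vm : List ℕ → Candidate) (n s t b b' : ℕ) : Candidate :=
  .out s (.out t (.both (Vi [s, t]) (.both (decWitness Vm n s b) (decWitness Vm n t b'))))

theorem primrec_splitWitness {Vi Vm : List ℕ → Candidate} (hVi : Primrec₂ Vi) (hVm : Primrec₂ Vm)
    {α : Type} [Primcodable α] {n s t b b' : α → ℕ} (hn : Primrec n) (hs : Primrec s)
    (ht : Primrec t) (hb : Primrec b) (hb' : Primrec b') :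
    Primrec₂ fun a => splitWitness Vi Vm (n a) (s a) (t a) (b a) (b' a) :=
  Candidate.primrec_out hs (Candidate.primrec_out ht (Candidate.primrec_both
    (U := fun a => Vi [s a, t a])
    (hVi.comp ((primrec_list_pair hs ht).comp Primrec.fst) Primrec.snd)
    (Candidate.primrec_both (primrec_decWitness hVm hn hs hb)
      (primrec_decWitness hVm hn ht hb'))))

theorem primrec_search_splitHit : Primrec (search splitHit) := by
  have h : Primrec fun x : ((Unit × List ℕ) × List ℕ) × ℕ => splitHit x.1.1.2 x.1.2 x.2 :=
    primrec_splitHit.comp (f := fun x : (List ℕ × List ℕ) × ℕ => splitHit x.1.1 x.1.2 x.2)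
      (g := fun x : ((Unit × List ℕ) × List ℕ) × ℕ => ((x.1.1.2, x.1.2), x.2))
      (Primrec.pair (Primrec.pair (Primrec.snd.comp (Primrec.fst.comp Primrec.fst))
        (Primrec.snd.comp Primrec.fst)) Primrec.snd)
  exact (primrec_search (H := fun _ : Unit => splitHit) h).comp (Primrec.const ()) Primrec.id

/-- Without a path, the sequences selected by any witness of `branch` include two incompatible ones;
waiting for two such decisions and copying them is a recursive response. -/
theorem exists_uniform_split (hT : ¬ IllFounded T) :
    ∃ X : ℕ → Candidate, Primrec₂ X ∧
      ∀ e : Fin 1 → ℕ, (Formula.imp D.branch D.split).Witnessed e (X (e 0)) := by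
  obtain ⟨Vi, hVi, hVi'⟩ := D.incomp_decidable.exists_uniform
  obtain ⟨Vm, hVm, hVm'⟩ := D.matrix_decidable.exists_uniform
  refine ⟨fun n => .respond (search splitHit)
    fun y => splitWitness Vi Vm n y.1.1 y.1.2 y.2.1 y.2.2, ?_, fun e Y hY => ?_⟩
  · refine Candidate.primrec_respond (F := fun _ => search splitHit)
      (B := fun n y => splitWitness Vi Vm n y.1.1 y.1.2 y.2.1 y.2.2)
      (primrec_search_splitHit.comp Primrec.snd) ?_
    exact primrec_splitWitness hVi hVm (α := ℕ × ((ℕ × ℕ) × ℕ × ℕ)) (n := fun a => a.1)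
      (s := fun a => a.2.1.1) (t := fun a => a.2.1.2) (b := fun a => a.2.2.1)
      (b' := fun a => a.2.2.2) Primrec.fst
      (Primrec.fst.comp (Primrec.fst.comp Primrec.snd))
      (Primrec.snd.comp (Primrec.fst.comp Primrec.snd))
      (Primrec.fst.comp (Primrec.snd.comp Primrec.snd))
      (Primrec.snd.comp (Primrec.snd.comp Primrec.snd))
  · obtain ⟨hbr, hdec⟩ := D.branch_of_witnessed hY
    choose s hsT hsl b r hb using hbr
    have : ∃ l m, Incompatible (s l) (s m) := by
      by_contra! h
      exact hT (illFounded_of_compatible hsl hsT h)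
    obtain ⟨l, m, hlm⟩ := this
    -- The hit at `l, m` only ensures that the search ends; the decisions `p, q` it finds may be
    -- different ones.
    obtain ⟨y, ⟨p, hp, q, hq, d, hy⟩, hF, hF'⟩ := search_spec (H := splitHit) (X := Y)
      ⟨_, hb l, _, hb m, 0, _, if_pos ⟨⟨⟨by simp, rfl, rfl⟩, ⟨by simp, rfl, rfl⟩⟩,
        by simpa using hlm⟩⟩
    rw [splitHit] at hy
    split_ifs at hy with hpq
    obtain ⟨⟨hpD, hqD⟩, hpq⟩ := hpq
    rw [Option.some_inj] at hy
    subst hy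
    refine (Formula.witnessed_congr _ _ (Candidate.pairs_app_respond hF hF')).2 ?_
    obtain ⟨lp, rp, hp'⟩ := hpD.eq_cons
    obtain ⟨lq, rq, hq'⟩ := hqD.eq_cons
    refine Candidate.witnessed_ex_out (Candidate.witnessed_ex_out
      (Candidate.witnessed_and_both ?_ (Candidate.witnessed_and_both ?_ ?_)))
    · rw [Formula.witnessed_rename, comp_pair]
      exact hVi' ![p.getD 1 0, q.getD 1 0] ((D.incomp_defines _).2
        ⟨_, _, Denumerable.encode_ofNat _, Denumerable.encode_ofNat _, hpq⟩)
    · exact D.witnessed_dec hVm' 0 1 (Fin.snoc (Fin.snoc e (p.getD 1 0)) (q.getD 1 0))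
        (hdec lp _ _ rp (hp' ▸ hp))
    · exact D.witnessed_dec hVm' 0 2 (Fin.snoc (Fin.snoc e (p.getD 1 0)) (q.getD 1 0))
        (hdec lq _ _ rq (hq' ▸ hq))

/-- What a witness of `combination` gives. -/
theorem combination_of_witnessed {e : Fin 1 → ℕ} {W : Candidate}
    (h : D.combination.Witnessed e W) : ∃ b : BoolComb, W.Outputs b.code ∧
      ¬ b.Tautological ∧ b.Eval (D.R (e 0)) := by
  obtain ⟨c, hc, hw, hf⟩ := h
  rw [Formula.witnessed_rename, comp_single] at hw
  obtain ⟨b, hb, hnt⟩ := (D.nontaut_defines _).1 hw.holds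
  have hbc : b.code = c := hb
  subst hbc
  refine ⟨b, hc, hnt, ?_⟩
  by_contra hE
  refine hf ?_
  rw [Formula.holds_rename, comp_pair]
  exact (D.isFalse_defines _).2 ⟨b, rfl, hE⟩

/-- Otherwise a non-tautological combination true of `R(n, ·)` would be computable from `n`, and
self-reference provides an `n` for which it is false. -/
theorem illFounded_of_constructivelyTrue (h : ConstructivelyTrue D.statement) :
    IllFounded T := by
  by_contra hT
  obtain ⟨W, hW, hWs⟩ := h.exists_primrec
  obtain ⟨X, hX, hXs⟩ := D.exists_uniform_split hT
  let app (n : ℕ) : Candidate := (W.strip n).app (X n)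
  have mem_app (n c : ℕ) (p : List ℕ) : c :: p ∈ (app n).pairs ↔
      ∃ k l, W k = some (n :: Encodable.encode (segment (X n) l) :: c :: p) := by
    rw [Candidate.mem_pairs_app, exists_comm]
    exact exists_congr fun l => Candidate.mem_pairs_strip
  have key (n : ℕ) : ∃ b : BoolComb, (app n).Outputs b.code ∧
      ¬ b.Tautological ∧ b.Eval (D.R n) :=
    D.combination_of_witnessed (hWs n (X n) (hXs (Fin.snoc Fin.elim0 n)))
  -- The `k`-th entry of `W` answers the segment of `X n` of length `l` at input `n` with a
  -- combination whose least falsifier `u` makes `m` false. The length bound keeps the default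
  -- values from counting as entries.
  let good (n m k l u : ℕ) : Prop := ((3 ≤ ((W k).getD []).length ∧ ((W k).getD []).getD 0 0 = n) ∧
    ((W k).getD []).getD 1 0 = Encodable.encode (segment (X n) l)) ∧
    LeastFalsifier (((W k).getD []).getD 2 0) u ∧ u.testBit m = false
  have good_iff (n m k l u : ℕ) : good n m k l u ↔ ∃ c p,
      W k = some (n :: Encodable.encode (segment (X n) l) :: c :: p) ∧
        LeastFalsifier c u ∧ u.testBit m = false := by
    constructor
    · rintro ⟨⟨⟨h1, h2⟩, h3⟩, h4, h5⟩
      rcases hk : W k with _ | p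
      · simp [hk] at h1
      · rw [hk] at h1 h2 h3 h4
        match p, h1 with
        | n' :: a :: c :: p, _ =>
          simp only [Option.getD_some, List.getD_cons_zero, List.getD_cons_succ] at h2 h3 h4
          subst h2 h3
          exact ⟨c, p, rfl, h4, h5⟩
    · rintro ⟨c, p, h, h4, h5⟩
      refine ⟨⟨⟨?_, ?_⟩, ?_⟩, ?_, h5⟩ <;> simp [h, h4]
  have good_prim : PrimrecPred fun x : (ℕ × ℕ) × ℕ =>
      good x.1.1 x.1.2 x.2.unpair.1 x.2.unpair.2.unpair.1 x.2.unpair.2.unpair.2 := by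
    have n : Primrec fun x : (ℕ × ℕ) × ℕ => x.1.1 := Primrec.fst.comp Primrec.fst
    have m : Primrec fun x : (ℕ × ℕ) × ℕ => x.1.2 := Primrec.snd.comp Primrec.fst
    have k : Primrec fun x : (ℕ × ℕ) × ℕ => x.2.unpair.1 :=
      Primrec.fst.comp (Primrec.unpair.comp Primrec.snd)
    have lu : Primrec fun x : (ℕ × ℕ) × ℕ => x.2.unpair.2.unpair :=
      Primrec.unpair.comp (Primrec.snd.comp (Primrec.unpair.comp Primrec.snd))
    have l := Primrec.fst.comp lu
    have u := Primrec.snd.comp lu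
    have w : Primrec fun x : (ℕ × ℕ) × ℕ => (W x.2.unpair.1).getD [] :=
      Primrec.option_getD.comp (hW.comp k) (Primrec.const [])
    exact (((Primrec.nat_le.comp (Primrec.const 3) (Primrec.list_length.comp w)).and
      (Primrec.eq.comp ((primrec_getD 0).comp w) n)).and
      (Primrec.eq.comp ((primrec_getD 1).comp w)
        (Primrec.encode.comp ((primrec_segment hX).comp n l)))).and
      ((primrecRel_leastFalsifier.comp ((primrec_getD 2).comp w) u).and
        (Primrec.eq.comp (primrec_testBit.comp u m) (Primrec.const false)))
  -- For this `n`, `R(n, m)` fails exactly when the falsifier of the combination computed from `n`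
  -- makes `m` false.
  obtain ⟨n, hn⟩ := D.matrix_universal.exists_fixed_point
    (N := fun n m => ∃ k l u, good n m k l u) (by
      classical
      refine REPred.of_exists_computable good_prim.decide.to_comp.to₂ fun x => ?_
      constructor
      · rintro ⟨k, l, u, h⟩
        exact ⟨Nat.pair k (Nat.pair l u), by simpa using h⟩
      · rintro ⟨t, ht⟩
        exact ⟨_, _, _, of_decide_eq_true ht⟩)
  obtain ⟨b, hb, hnt, hE⟩ := key n
  obtain ⟨u, hu⟩ := exists_leastFalsifier hnt
  rw [Candidate.outputs_iff] at hb
  -- All entries give the same combination, and its least falsifier is unique, so `R(n, ·)` is one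
  -- coherent valuation.
  have hR (m : ℕ) : D.R n m ↔ u.testBit m = true := by
    rw [← Bool.not_eq_false, ← not_iff_not.2 (Iff.refl (u.testBit m = false))]
    refine (hn m).trans (not_congr ⟨?_, fun h => ?_⟩)
    · rintro ⟨k, l, w, h⟩
      obtain ⟨c, p, hk, hc, hw⟩ := (good_iff _ _ _ _ _).1 h
      obtain rfl := hb.2 c p ((mem_app n c p).2 ⟨k, l, hk⟩)
      rwa [hu.unique hc]
    · obtain ⟨p, hp⟩ := hb.1
      obtain ⟨k, l, hk⟩ := (mem_app n _ p).1 hp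
      exact ⟨k, l, u, (good_iff _ _ _ _ _).2 ⟨_, p, hk, hu, h⟩⟩
  exact hu.not_eval ((b.eval_congr fun i _ => hR i).1 hE)

end Presentation

/-! ## Clauses -/

/-- The literal that `m` has the truth value told by `b`. -/
def literal (m b : ℕ) : BoolComb := if b = 0 then .atom m else .neg (.atom m)

/-- The clause that one of the propositions `s l`, for `l < L`, does not have the truth value told
by `β l`, or `m` has the truth value told by `b`. -/
def clause (s β : ℕ → ℕ) (m b : ℕ) : ℕ → BoolComb
  | 0 => literal m b
  | L + 1 => .or (.neg (literal (s L) (β L))) (clause s β m b L)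

theorem eval_literal (v : ℕ → Prop) (m b : ℕ) : (literal m b).Eval v ↔ (v m ↔ b = 0) := by
  unfold literal
  split_ifs with h <;> simp [BoolComb.Eval, h]

theorem eval_clause (v : ℕ → Prop) (s β : ℕ → ℕ) (m b L : ℕ) :
    (clause s β m b L).Eval v ↔ ((∀ l < L, v (s l) ↔ β l = 0) → (v m ↔ b = 0)) := by
  induction L with
  | zero => simp [clause, eval_literal]
  | succ L ih =>
    simp only [clause, BoolComb.Eval, ih, eval_literal, Nat.forall_lt_succ_right]
    tauto

/-- The clause is an implication about distinct atoms, so its hypothesis can be made true and its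
conclusion false. Injectivity keeps arbitrary `β` consistent. -/
theorem not_tautological_clause {s β : ℕ → ℕ} {m b L : ℕ} (hs : Function.Injective s)
    (hm : ∀ l < L, s l ≠ m) : ¬ (clause s β m b L).Tautological := by
  intro h
  -- This valuation gives `m` the wrong value and each `s l` the value told by `β l`.
  have := (eval_clause (fun x => if x = m then b ≠ 0 else ∃ l, x = s l ∧ β l = 0) s β m b L).1 (h _)
    fun l hl => by
      rw [if_neg (hm l hl)]
      exact ⟨fun ⟨l', h, h'⟩ => hs h ▸ h', fun h => ⟨l, rfl, h⟩⟩
  simp at this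

theorem primrec_code_literal : Primrec₂ fun m b => (literal m b).code := by
  have h : Primrec fun x : ℕ × ℕ => Nat.pair 0 x.1 :=
    Primrec₂.natPair.comp (Primrec.const 0) Primrec.fst
  refine Primrec.of_eq (Primrec.ite (Primrec.eq.comp Primrec.snd (Primrec.const 0)) h
    (Primrec₂.natPair.comp (Primrec.const 1) h)) fun x => ?_
  beta_reduce
  unfold literal
  split_ifs <;> rfl

theorem primrec_code_clause {α : Type} [Primcodable α] {s β : α → ℕ → ℕ} {m b L : α → ℕ}
    (hs : Primrec₂ s) (hβ : Primrec₂ β) (hm : Primrec m) (hb : Primrec b) (hL : Primrec L) :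
    Primrec fun a => (clause (s a) (β a) (m a) (b a) (L a)).code := by
  have hl : Primrec₂ fun (a : α) (x : ℕ × ℕ) => (literal (s a x.1) (β a x.1)).code :=
    primrec_code_literal.comp (hs.comp Primrec.fst (Primrec.fst.comp Primrec.snd))
      (hβ.comp Primrec.fst (Primrec.fst.comp Primrec.snd))
  have hstep : Primrec₂ fun (a : α) (x : ℕ × ℕ) =>
      Nat.pair 3 (Nat.pair (Nat.pair 1 (literal (s a x.1) (β a x.1)).code) x.2) :=
    Primrec₂.natPair.comp (Primrec.const 3) (Primrec₂.natPair.comp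
      (Primrec₂.natPair.comp (Primrec.const 1) hl) (Primrec.snd.comp Primrec.snd))
  have h : Primrec₂ fun (a : α) n => (clause (s a) (β a) (m a) (b a) n).code := by
    refine (Primrec.nat_rec (primrec_code_literal.comp hm hb) hstep).of_eq fun a n => ?_
    induction n with
    | zero => rfl
    | succ n ih => rw [clause, BoolComb.code, BoolComb.code, ← ih]
  exact h.comp Primrec.id hL

/-! ## The uniform implication holds constructively for ill-founded trees -/

/-- The code of the initial segment of length `l` of the sequence `u`. -/
def prefixCode (u : List ℕ) (l : ℕ) : ℕ := Encodable.encode (segment (fun i => u.getD i 0) l)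

theorem primrec_prefixCode : Primrec₂ prefixCode :=
  Primrec.encode.comp (primrec_segment (Primrec.list_getD 0))

theorem segment_injective {α : Type} (f : ℕ → α) : Function.Injective (segment f) := by
  intro l m h
  simpa [length_segment] using congrArg List.length h

theorem prefixCode_injective (u : List ℕ) : Function.Injective (prefixCode u) :=
  Encodable.encode_injective.comp (segment_injective _)

theorem segment_congr {α : Type} {f g : ℕ → α} {L : ℕ} (h : ∀ i < L, f i = g i) :
    segment f L = segment g L :=
  List.map_congr_left fun i hi => h i (List.mem_range.1 hi)

theorem segment_prefix {α : Type} (f : ℕ → α) {l m : ℕ} (h : l ≤ m) :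
    segment f l <+: segment f m := by
  obtain ⟨d, rfl⟩ := Nat.exists_eq_add_of_le h
  rw [segment, segment, List.range_add, List.map_append]
  exact List.prefix_append _ _

theorem segment_getD_prefix (u : List ℕ) {l : ℕ} (h : l ≤ u.length) :
    segment (fun i => u.getD i 0) l <+: u := by
  have : u = segment (fun i => u.getD i 0) u.length := by
    refine List.ext_getElem (length_segment _ _).symm fun i h1 h2 => ?_
    simp [segment, h1]
  conv_rhs => rw [this]
  exact segment_prefix _ h

/-- A candidate that selects the sequence `s l` for every length `l`, and tells the truth value of
`R(n, s l)` according to `β l`. -/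
def branchWitness (Vl Vt Vm : List ℕ → Candidate) (n : ℕ) (s β : ℕ → ℕ) : Candidate :=
  .tabulate fun l => .out (s l)
    (.both (Vl [s l, l]) (.both (Vt [s l]) (decWitness Vm n (s l) (β l))))

/-- Position `k` of a table belongs to the row `k.unpair.1 ≤ k`, so the first `L` positions involve
only lengths below `L`. This is how a finite guess determines the input read by `X`. -/
theorem segment_branchWitness_congr {Vl Vt Vm : List ℕ → Candidate} {n : ℕ} {s s' β β' : ℕ → ℕ}
    {L : ℕ} (hs : ∀ l < L, s l = s' l) (hβ : ∀ l < L, β l = β' l) :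
    segment (branchWitness Vl Vt Vm n s β) L = segment (branchWitness Vl Vt Vm n s' β') L := by
  refine segment_congr fun k hk => ?_
  have := (Nat.unpair_left_le k).trans_lt hk
  simp only [branchWitness, Candidate.tabulate]
  rw [hs _ this, hβ _ this]

section Primrec

variable {Vl Vt Vm : List ℕ → Candidate} {α : Type} [Primcodable α]

theorem primrec_branchWitness (hVl : Primrec₂ Vl) (hVt : Primrec₂ Vt) (hVm : Primrec₂ Vm)
    {n : α → ℕ} {s β : α → ℕ → ℕ} (hn : Primrec n) (hs : Primrec₂ s) (hβ : Primrec₂ β) :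
    Primrec₂ fun a => branchWitness Vl Vt Vm (n a) (s a) (β a) := by
  have hs' : Primrec fun x : α × ℕ => s x.1 x.2 := hs
  have h : Primrec₂ fun x : α × ℕ => Candidate.out (s x.1 x.2) (.both (Vl [s x.1 x.2, x.2])
      (.both (Vt [s x.1 x.2]) (decWitness Vm (n x.1) (s x.1 x.2) (β x.1 x.2)))) :=
    Candidate.primrec_out hs' (Candidate.primrec_both (U := fun x : α × ℕ => Vl [s x.1 x.2, x.2])
      (hVl.comp ((primrec_list_pair hs' Primrec.snd).comp Primrec.fst) Primrec.snd)
      (Candidate.primrec_both (U := fun x : α × ℕ => Vt [s x.1 x.2])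
        (hVt.comp ((Primrec.list_cons.comp hs' (Primrec.const [])).comp Primrec.fst) Primrec.snd)
        (primrec_decWitness hVm (hn.comp Primrec.fst) hs' hβ)))
  exact Candidate.primrec_tabulate h

end Primrec

/-- `p` is an entry `a, s, t, 1, i, b, …` of a witness for the implication from `branch` to
`split`. -/
def IsSplitting (p : List ℕ) : Prop :=
  (6 ≤ p.length ∧ p.getD 3 0 = 1) ∧ (p.getD 4 0 = 0 ∨ p.getD 4 0 = 1)

instance : DecidablePred IsSplitting := fun p => by unfold IsSplitting; infer_instance

theorem IsSplitting.eq_cons {p : List ℕ} (h : IsSplitting p) : ∃ r, p =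
    p.getD 0 0 :: p.getD 1 0 :: p.getD 2 0 :: 1 :: p.getD 4 0 :: p.getD 5 0 :: r := by
  obtain ⟨⟨h0, h1⟩, -⟩ := h
  match p, h0 with
  | a :: s :: t :: x :: i :: b :: r, _ =>
    simp only [List.getD_cons_succ, List.getD_cons_zero] at h1
    exact ⟨r, by simp [h1]⟩

/-- The sequence about which `p` decides. -/
def splittingTarget (p : List ℕ) : ℕ := if p.getD 4 0 = 0 then p.getD 1 0 else p.getD 2 0

theorem primrecPred_isSplitting : PrimrecPred IsSplitting :=
  ((Primrec.nat_le.comp (Primrec.const 6) Primrec.list_length).and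
    (Primrec.eq.comp (primrec_getD 3) (Primrec.const 1))).and
    ((Primrec.eq.comp (primrec_getD 4) (Primrec.const 0)).or
      (Primrec.eq.comp (primrec_getD 4) (Primrec.const 1)))

theorem primrec_splittingTarget : Primrec splittingTarget :=
  Primrec.ite (Primrec.eq.comp (primrec_getD 4) (Primrec.const 0)) (primrec_getD 1)
    (primrec_getD 2)

/-- If `p` is a decision made from the finite information `u`, `bs` about branches, and the target
is not among the initial segments of `u`, then the corresponding clause. -/
def clauseOf (Vl Vt Vm : List ℕ → Candidate) (n : ℕ) (p u bs : List ℕ) : Option ℕ :=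
  if (IsSplitting p ∧ p.getD 0 0 = Encodable.encode
      (segment (branchWitness Vl Vt Vm n (prefixCode u) fun l => bs.getD l 0) u.length)) ∧
      ∀ l < u.length, prefixCode u l ≠ splittingTarget p
  then some (clause (prefixCode u) (fun l => bs.getD l 0) (splittingTarget p) (p.getD 5 0)
    u.length).code
  else none

/-- Search for a clause, where `w` enumerates the tree. -/
def clauseHit (Vl Vt Vm : List ℕ → Candidate) (w : ℕ → Option (List ℕ)) (n : ℕ) (p _q : List ℕ)
    (d : ℕ) : Option ℕ :=
  (w d.unpair.1).bind fun u => clauseOf Vl Vt Vm n p u (Denumerable.ofNat (List ℕ) d.unpair.2)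

section Primrec

variable {Vl Vt Vm : List ℕ → Candidate}

theorem primrec_clauseOf (hVl : Primrec₂ Vl) (hVt : Primrec₂ Vt) (hVm : Primrec₂ Vm) :
    Primrec fun x : (ℕ × List ℕ) × (List ℕ × List ℕ) =>
      clauseOf Vl Vt Vm x.1.1 x.1.2 x.2.1 x.2.2 := by
  have n : Primrec fun x : (ℕ × List ℕ) × (List ℕ × List ℕ) => x.1.1 := Primrec.fst.comp Primrec.fst
  have p : Primrec fun x : (ℕ × List ℕ) × (List ℕ × List ℕ) => x.1.2 := Primrec.snd.comp Primrec.fst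
  have u : Primrec fun x : (ℕ × List ℕ) × (List ℕ × List ℕ) => x.2.1 := Primrec.fst.comp Primrec.snd
  have bs : Primrec fun x : (ℕ × List ℕ) × (List ℕ × List ℕ) => x.2.2 :=
    Primrec.snd.comp Primrec.snd
  have s : Primrec₂ fun (x : (ℕ × List ℕ) × (List ℕ × List ℕ)) l => prefixCode x.2.1 l :=
    primrec_prefixCode.comp (u.comp Primrec.fst) Primrec.snd
  have β : Primrec₂ fun (x : (ℕ × List ℕ) × (List ℕ × List ℕ)) l => x.2.2.getD l 0 :=
    (Primrec.list_getD 0).comp (bs.comp Primrec.fst) Primrec.snd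
  have m := primrec_splittingTarget.comp p
  have len := Primrec.list_length.comp u
  have seg : Primrec fun x : (ℕ × List ℕ) × (List ℕ × List ℕ) => Encodable.encode (segment
      (branchWitness Vl Vt Vm x.1.1 (prefixCode x.2.1) fun l => x.2.2.getD l 0) x.2.1.length) :=
    Primrec.encode.comp
      ((primrec_segment (primrec_branchWitness hVl hVt hVm n s β)).comp Primrec.id len)
  have ne : PrimrecRel fun (l : ℕ) (y : List ℕ × ℕ) => prefixCode y.1 l ≠ y.2 :=
    (Primrec.eq.comp (primrec_prefixCode.comp (Primrec.fst.comp Primrec.snd) Primrec.fst)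
      (Primrec.snd.comp Primrec.snd)).not
  have all : PrimrecPred fun x : (ℕ × List ℕ) × (List ℕ × List ℕ) =>
      ∀ l < x.2.1.length, prefixCode x.2.1 l ≠ splittingTarget x.1.2 := by
    have h := ne.forall_mem_list.comp (Primrec.list_range.comp len) (u.pair m)
    exact h.of_eq fun x => by simp
  exact Primrec.ite (((primrecPred_isSplitting.comp p).and
    (Primrec.eq.comp ((primrec_getD 0).comp p) seg)).and all)
    (Primrec.option_some.comp (primrec_code_clause s β m ((primrec_getD 5).comp p) len))
    (Primrec.const none)

theorem primrec_clauseHit (hVl : Primrec₂ Vl) (hVt : Primrec₂ Vt) (hVm : Primrec₂ Vm)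
    {w : ℕ → Option (List ℕ)} (hw : Primrec w) :
    Primrec fun x : ((ℕ × List ℕ) × List ℕ) × ℕ =>
      clauseHit Vl Vt Vm w x.1.1.1 x.1.1.2 x.1.2 x.2 := by
  have d : Primrec fun x : ((ℕ × List ℕ) × List ℕ) × ℕ => x.2.unpair :=
    Primrec.unpair.comp Primrec.snd
  have h : Primrec fun x : (((ℕ × List ℕ) × List ℕ) × ℕ) × List ℕ =>
      clauseOf Vl Vt Vm x.1.1.1.1 x.1.1.1.2 x.2 (Denumerable.ofNat (List ℕ) x.1.2.unpair.2) :=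
    (primrec_clauseOf hVl hVt hVm).comp (Primrec.pair
      (Primrec.fst.comp (Primrec.fst.comp Primrec.fst))
      (Primrec.pair Primrec.snd ((Primrec.ofNat (List ℕ)).comp (Primrec.snd.comp
        (d.comp Primrec.fst)))))
  exact Primrec.option_bind (hw.comp (Primrec.fst.comp d)) h.to₂

end Primrec

namespace Presentation

variable {T : Set (List ℕ)} (D : Presentation T) {Vl Vt Vm : List ℕ → Candidate}

theorem witnessed_branchWitness
    (hVl : ∀ e : Fin 2 → ℕ, D.len.Holds e → D.len.Witnessed e (Vl (List.ofFn e)))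
    (hVt : ∀ e : Fin 1 → ℕ, D.tree.Holds e → D.tree.Witnessed e (Vt (List.ofFn e)))
    (hVm : ∀ e : Fin 3 → ℕ, D.matrix.Holds e → D.matrix.Witnessed e (Vm (List.ofFn e)))
    (e : Fin 1 → ℕ) {s β : ℕ → ℕ} (hs : ∀ l, ∃ t ∈ T, t.length = l ∧ Encodable.encode t = s l)
    (hβ : ∀ l, D.R (e 0) (s l) ↔ β l = 0) :
    D.branch.Witnessed e (branchWitness Vl Vt Vm (e 0) s β) := by
  refine Candidate.witnessed_all_tabulate fun l => Candidate.witnessed_ex_out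
    (Candidate.witnessed_and_both ?_ (Candidate.witnessed_and_both ?_ ?_))
  all_goals obtain ⟨t, htT, htl, ht⟩ := hs l
  · rw [Formula.witnessed_rename, comp_pair]
    exact hVl ![s l, l] (ht ▸ (D.len_holds_iff t l).2 htl)
  · rw [Formula.witnessed_rename, comp_single]
    exact hVt ![s l] (ht ▸ (D.tree_holds_iff t).2 htT)
  · exact D.witnessed_dec hVm 0 2 (Fin.snoc (Fin.snoc e l) (s l)) (hβ l)

theorem exists_truthValues (n : ℕ) (s : ℕ → ℕ) : ∃ β : ℕ → ℕ, ∀ l, D.R n (s l) ↔ β l = 0 := by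
  classical
  exact ⟨fun l => if D.R n (s l) then 0 else 1, fun l => by simp⟩

/-- A witness for `split` outputs decisions about incompatible sequences. -/
theorem split_of_witnessed {e : Fin 1 → ℕ} {W : Candidate} (h : D.split.Witnessed e W) :
    (∃ s t : List ℕ, Incompatible s t ∧
      (∃ b r, Encodable.encode s :: Encodable.encode t :: 1 :: 0 :: b :: r ∈ W.pairs) ∧
      ∃ b r, Encodable.encode s :: Encodable.encode t :: 1 :: 1 :: b :: r ∈ W.pairs) ∧
    ∀ s t b r, (s :: t :: 1 :: 0 :: b :: r ∈ W.pairs → (D.R (e 0) s ↔ b = 0)) ∧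
      (s :: t :: 1 :: 1 :: b :: r ∈ W.pairs → (D.R (e 0) t ↔ b = 0)) := by
  obtain ⟨s, hs, t, ht, hi, hds, hdt⟩ := h
  have hs' := (D.eq_zero_of_witnessed_dec hds)
  have ht' := (D.eq_zero_of_witnessed_dec hdt)
  simp only [Candidate.mem_pairs_strip] at hs' ht'
  rw [Candidate.outputs_iff] at hs ht
  simp only [Candidate.mem_pairs_strip] at ht
  constructor
  · rw [Formula.witnessed_rename, comp_pair] at hi
    obtain ⟨s', t', hs'', ht'', hi⟩ := (D.incomp_defines _).1 hi.holds
    have h1 : Encodable.encode s' = s := hs''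
    have h2 : Encodable.encode t' = t := ht''
    exact ⟨s', t', hi, h1 ▸ h2 ▸ hs'.1, h1 ▸ h2 ▸ ht'.1⟩
  · intro s1 t1 b r
    constructor
    all_goals
      intro hp
      obtain rfl := hs.2 _ _ hp
      obtain rfl := ht.2 _ _ hp
    · exact (hs'.2 b r hp).2
    · exact (ht'.2 b r hp).2

/-- If the hypothesis of the clause is true, the finite input extends to a real witness of `branch`,
and then `X` must have decided the target correctly. The path `g` supplies the sequences of the
lengths that `u` leaves open. -/
theorem eval_of_clauseOf (hT : IsTree T) {g : ℕ → ℕ} (hg : ∀ l, segment g l ∈ T)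
    (hVl : ∀ e : Fin 2 → ℕ, D.len.Holds e → D.len.Witnessed e (Vl (List.ofFn e)))
    (hVt : ∀ e : Fin 1 → ℕ, D.tree.Holds e → D.tree.Witnessed e (Vt (List.ofFn e)))
    (hVm : ∀ e : Fin 3 → ℕ, D.matrix.Holds e → D.matrix.Witnessed e (Vm (List.ofFn e)))
    {e : Fin 1 → ℕ} {X : Candidate} (hX : (Formula.imp D.branch D.split).Witnessed e X)
    {p u bs : List ℕ} (hu : u ∈ T) (hp : p ∈ X.pairs) {c : ℕ}
    (hc : clauseOf Vl Vt Vm (e 0) p u bs = some c) :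
    ∃ b : BoolComb, b.code = c ∧ ¬ b.Tautological ∧ b.Eval (D.R (e 0)) := by
  rw [clauseOf] at hc
  split_ifs at hc with h
  obtain ⟨⟨h1, h2⟩, h3⟩ := h
  rw [Option.some_inj] at hc
  refine ⟨_, hc, not_tautological_clause (prefixCode_injective u) h3, ?_⟩
  rw [eval_clause]
  intro hassert
  -- Initial segments of `u` as far as they were read, and of `g` afterwards; the two parts need not
  -- be compatible.
  let s (l : ℕ) : ℕ := if l < u.length then prefixCode u l else Encodable.encode (segment g l)
  obtain ⟨γ, hγ⟩ := D.exists_truthValues (e 0) s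
  let β (l : ℕ) : ℕ := if l < u.length then bs.getD l 0 else γ l
  have hY := D.witnessed_branchWitness hVl hVt hVm e (s := s) (β := β) (fun l => by
    by_cases hl : l < u.length
    · exact ⟨segment (fun i => u.getD i 0) l, hT _ _ (segment_getD_prefix u hl.le) hu,
        length_segment _ _, by simp only [s, if_pos hl]; rfl⟩
    · exact ⟨segment g l, hg l, length_segment _ _, by simp only [s, if_neg hl]⟩) (fun l => by
    by_cases hl : l < u.length
    · simpa only [s, β, if_pos hl] using hassert l hl
    · simpa only [β, if_neg hl] using hγ l)
  have hseg : segment (branchWitness Vl Vt Vm (e 0) s β) u.length =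
      segment (branchWitness Vl Vt Vm (e 0) (prefixCode u) fun l => bs.getD l 0) u.length :=
    segment_branchWitness_congr (fun l hl => if_pos hl) fun l hl => if_pos hl
  have hsplit := (D.split_of_witnessed (hX _ hY)).2
  obtain ⟨r, hr⟩ := h1.eq_cons
  have hmem : p.getD 1 0 :: p.getD 2 0 :: 1 :: p.getD 4 0 :: p.getD 5 0 :: r ∈
      (X.app (branchWitness Vl Vt Vm (e 0) s β)).pairs := by
    refine Candidate.mem_pairs_app.2 ⟨u.length, ?_⟩
    rw [hseg, ← h2, ← hr]
    exact hp
  rw [splittingTarget]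
  rcases h1.2 with h4 | h4
  · rw [if_pos h4]
    rw [h4] at hmem
    exact (hsplit _ _ _ _).1 hmem
  · rw [if_neg (by omega)]
    rw [h4] at hmem
    exact (hsplit _ _ _ _).2 hmem

/-- `X` applied to the truthful witness along `g` decides two incompatible sequences, and at most
one of them lies on `g`; the decision about the other passes the tests of `clauseOf`. -/
theorem exists_clauseOf {g : ℕ → ℕ} (hg : ∀ l, segment g l ∈ T)
    (hVl : ∀ e : Fin 2 → ℕ, D.len.Holds e → D.len.Witnessed e (Vl (List.ofFn e)))
    (hVt : ∀ e : Fin 1 → ℕ, D.tree.Holds e → D.tree.Witnessed e (Vt (List.ofFn e)))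
    (hVm : ∀ e : Fin 3 → ℕ, D.matrix.Holds e → D.matrix.Witnessed e (Vm (List.ofFn e)))
    {e : Fin 1 → ℕ} {X : Candidate} (hX : (Formula.imp D.branch D.split).Witnessed e X) :
    ∃ p ∈ X.pairs, ∃ u ∈ T, ∃ bs c,
    clauseOf Vl Vt Vm (e 0) p u bs = some c := by
  obtain ⟨β, hβ⟩ := D.exists_truthValues (e 0) fun l => Encodable.encode (segment g l)
  have hY := D.witnessed_branchWitness hVl hVt hVm e (fun l => ⟨segment g l, hg l,
    length_segment _ _, rfl⟩) hβ
  -- An answer to the segment of length `L` is matched by the guesses `segment g L` and `segment β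
  -- L`.
  have found (L m i b a s t : ℕ) (r : List ℕ) (hi : i = 0 ∧ m = s ∨ i = 1 ∧ m = t)
      (hm : ∀ l, Encodable.encode (segment g l) ≠ m) (ha : a = Encodable.encode (segment
        (branchWitness Vl Vt Vm (e 0) (fun l => Encodable.encode (segment g l)) β) L)) :
      ∃ c, clauseOf Vl Vt Vm (e 0) (a :: s :: t :: 1 :: i :: b :: r) (segment g L)
        (segment β L) = some c := by
    have hpre (l : ℕ) (hl : l < L) :
        Encodable.encode (segment g l) = prefixCode (segment g L) l :=
      congrArg Encodable.encode (segment_congr fun i hi =>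
        (getD_segment g 0 (hi.trans hl)).symm)
    refine ⟨_, if_pos ⟨⟨⟨⟨by simp, rfl⟩, ?_⟩, ?_⟩, ?_⟩⟩
    · rcases hi with hi | hi
      · exact Or.inl hi.1
      · exact Or.inr hi.1
    · rw [List.getD_cons_zero, ha, length_segment]
      exact congrArg Encodable.encode (segment_branchWitness_congr hpre
        fun l hl => (getD_segment β 0 hl).symm)
    · intro l hl
      rw [length_segment] at hl
      rw [← hpre l hl]
      have : splittingTarget (a :: s :: t :: 1 :: i :: b :: r) = m := by
        rcases hi with ⟨rfl, rfl⟩ | ⟨rfl, rfl⟩ <;> rfl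
      rw [this]
      exact hm l
  obtain ⟨s, t, hst, ⟨b, r, hs⟩, b', r', ht⟩ := (D.split_of_witnessed (hX _ hY)).1
  obtain ⟨L, hs⟩ := Candidate.mem_pairs_app.1 hs
  obtain ⟨L', ht⟩ := Candidate.mem_pairs_app.1 ht
  -- Two initial segments of `g` are compatible, so `s` or `t` is off the path.
  by_cases hsg : ∃ l, segment g l = s
  · by_cases htg : ∃ l, segment g l = t
    · obtain ⟨l, rfl⟩ := hsg
      obtain ⟨m, rfl⟩ := htg
      rcases le_total l m with h | h
      · exact (hst.1 (segment_prefix g h)).elim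
      · exact (hst.2 (segment_prefix g h)).elim
    · obtain ⟨c, hc⟩ := found L' (Encodable.encode t) 1 b' _ (Encodable.encode s)
        (Encodable.encode t) r' (Or.inr ⟨rfl, rfl⟩)
        (fun l h => htg ⟨l, Encodable.encode_injective h⟩) rfl
      exact ⟨_, ht, _, hg L', _, c, hc⟩
  · obtain ⟨c, hc⟩ := found L (Encodable.encode s) 0 b _ (Encodable.encode s)
      (Encodable.encode t) r (Or.inl ⟨rfl, rfl⟩)
      (fun l h => hsg ⟨l, Encodable.encode_injective h⟩) rfl
    exact ⟨_, hs, _, hg L, _, c, hc⟩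

/-- The search for a clause uses an enumeration of `T` but not the path, so it is recursive; the
path guarantees that it ends and that the clause is true. -/
theorem constructivelyTrue_of_illFounded (hT : IsRecursiveTree T) (h : IllFounded T) :
    ConstructivelyTrue D.statement := by
  obtain ⟨g, hg⟩ := h
  obtain ⟨Vl, hVl, hVl'⟩ := D.len_decidable.exists_uniform
  obtain ⟨Vt, hVt, hVt'⟩ := D.tree_decidable.exists_uniform
  obtain ⟨Vm, hVm, hVm'⟩ := D.matrix_decidable.exists_uniform
  obtain ⟨Vn, hVn, hVn'⟩ := D.nontaut_decidable.exists_uniform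
  obtain ⟨w, hw, hwT⟩ := REPred.exists_enumeration hT.2.to_re
  let B (c : ℕ) : Candidate := .out c (.both (Vn [c]) fun _ => none)
  refine ⟨.tabulate fun n => .respond (search (clauseHit Vl Vt Vm w n)) B, ?_, ?_⟩
  · have hB : Primrec₂ B := Candidate.primrec_out Primrec.id (Candidate.primrec_both
      (U := fun c => Vn [c]) (hVn.comp ((Primrec.list_cons.comp Primrec.id
        (Primrec.const [])).comp Primrec.fst) Primrec.snd) (Primrec.const none).to₂)
    have hr : Primrec₂ fun n => Candidate.respond (search (clauseHit Vl Vt Vm w n)) B :=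
      Candidate.primrec_respond (B := fun _ => B)
        (primrec_search (primrec_clauseHit hVl hVt hVm hw))
        (hB.comp (Primrec.snd.comp Primrec.fst) Primrec.snd)
    have ht : Primrec₂ fun _ : Unit => Candidate.tabulate fun n =>
        Candidate.respond (search (clauseHit Vl Vt Vm w n)) B :=
      Candidate.primrec_tabulate (W := fun (_ : Unit) n =>
        Candidate.respond (search (clauseHit Vl Vt Vm w n)) B)
        (hr.comp (Primrec.snd.comp Primrec.fst) Primrec.snd)
    exact (ht.comp (Primrec.const ()) Primrec.id).to_comp
  · refine Candidate.witnessed_all_tabulate fun n X hX => ?_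
    obtain ⟨p, hp, u, hu, bs, c, hc⟩ := D.exists_clauseOf hg hVl' hVt' hVm' hX
    obtain ⟨k, hk⟩ := (hwT u).1 hu
    obtain ⟨c, ⟨p, hp, q, -, d, hcd⟩, hF, hF'⟩ := search_spec (H := clauseHit Vl Vt Vm w n) (X := X)
      ⟨p, hp, p, hp, Nat.pair k (Encodable.encode bs), c, by
        rw [clauseHit, Nat.unpair_pair, hk]
        change clauseOf Vl Vt Vm n p u (Denumerable.ofNat (List ℕ) (Encodable.encode bs)) = _
        rw [Denumerable.ofNat_encode]
        exact hc⟩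
    obtain ⟨u, hu, hc⟩ := Option.bind_eq_some_iff.1 hcd
    obtain ⟨b, hbc, hnt, hE⟩ := D.eval_of_clauseOf hT.1 hg hVl' hVt' hVm' hX
      ((hwT u).2 ⟨_, hu⟩) hp hc
    refine (Formula.witnessed_congr _ _ (Candidate.pairs_app_respond hF hF')).2 ?_
    refine Candidate.witnessed_ex_out (Candidate.witnessed_and_both ?_ ?_)
    · rw [Formula.witnessed_rename, comp_single]
      exact hVn' ![c] ((D.nontaut_defines _).2 ⟨b, hbc, hnt⟩)
    · change ¬ _
      rw [Formula.holds_rename, comp_pair]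
      intro hf
      obtain ⟨b', hb', hE'⟩ := (D.isFalse_defines _).1 hf
      obtain rfl := BoolComb.code_injective (hb'.trans hbc.symm)
      exact hE' hE

end Presentation

/-! ## Effectively closed sets and a normal form for `Σ¹₁` sets -/

/-- Uniformly effectively closed subsets of Baire space: the sets of paths through a uniformly
primitive recursive family of trees. -/
def EffectivelyClosed {α : Type} [Primcodable α] (C : α → Set (ℕ → ℕ)) : Prop :=
  ∃ K : α → List ℕ → Prop, PrimrecRel K ∧ (∀ a s t, s <+: t → K a t → K a s) ∧
    ∀ a g, g ∈ C a ↔ ∀ l, K a (segment g l)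

namespace EffectivelyClosed

variable {α : Type} [Primcodable α]

theorem inter {C D : α → Set (ℕ → ℕ)} (hC : EffectivelyClosed C) (hD : EffectivelyClosed D) :
    EffectivelyClosed fun a => C a ∩ D a := by
  obtain ⟨K, hK, hK', hKC⟩ := hC
  obtain ⟨L, hL, hL', hLD⟩ := hD
  refine ⟨fun a s => K a s ∧ L a s, hK.and hL,
    fun a s t hst h => ⟨hK' a s t hst h.1, hL' a s t hst h.2⟩, fun a g => ?_⟩
  rw [Set.mem_inter_iff, hKC, hLD, ← forall_and]

/-- A sequence of length `l` is tested for the first `l` conditions only. Each condition is still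
enforced at every length, since closure under initial segments passes it down from longer segments.
-/
theorem iInter {C : α → ℕ → Set (ℕ → ℕ)}
    (hC : EffectivelyClosed fun x : α × ℕ => C x.1 x.2) :
    EffectivelyClosed fun a => {g | ∀ n, g ∈ C a n} := by
  obtain ⟨K, hK, hK', hKC⟩ := hC
  refine ⟨fun a s => ∀ n < s.length, K (a, n) s, ?_, fun a s t hst h n hn => ?_, fun a g => ?_⟩
  · have h1 : PrimrecRel fun (n : ℕ) (x : α × List ℕ) => K (x.1, n) x.2 :=
      hK.comp (Primrec.pair (Primrec.fst.comp Primrec.snd) Primrec.fst)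
        (Primrec.snd.comp Primrec.snd)
    have h2 := h1.forall_mem_list.comp
      (Primrec.list_range.comp (Primrec.list_length.comp (Primrec.snd (α := α) (β := List ℕ))))
      Primrec.id
    exact h2.of_eq fun x => by simp
  · exact hK' _ s t hst (h n (hn.trans_le hst.length_le))
  · have h (n : ℕ) : g ∈ C a n ↔ ∀ l, K (a, n) (segment g l) := hKC (a, n) g
    simp only [Set.mem_ofPred_eq, h, length_segment]
    constructor
    · exact fun h l n _ => h n l
    · exact fun h n l => hK' _ _ _ (segment_prefix g (le_max_left l (n + 1)))
        (h _ n (by have := le_max_right l (n + 1); omega))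

theorem getD_eq_of_isPrefix {s t : List ℕ} (h : s <+: t) {i : ℕ} (hi : i < s.length) :
    t.getD i 0 = s.getD i 0 := by
  obtain ⟨r, rfl⟩ := h
  exact List.getD_append _ _ _ _ hi

/-- A primitive recursive condition on three values. -/
theorem of_values {x y z : α → ℕ} (hx : Primrec x) (hy : Primrec y) (hz : Primrec z)
    {P : α → ℕ × ℕ × ℕ → Prop} (hP : PrimrecRel P) :
    EffectivelyClosed fun a => {g | P a (g (x a), g (y a), g (z a))} := by
  -- A sequence is unrestricted until it is long enough to contain all three places.
  refine ⟨fun a s => ¬ (x a < s.length ∧ y a < s.length ∧ z a < s.length) ∨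
    P a (s.getD (x a) 0, s.getD (y a) 0, s.getD (z a) 0), ?_, fun a s t hst h => ?_, fun a g => ?_⟩
  · have len : Primrec fun w : α × List ℕ => w.2.length := Primrec.list_length.comp Primrec.snd
    have get {f : α → ℕ} (hf : Primrec f) : Primrec fun w : α × List ℕ => w.2.getD (f w.1) 0 :=
      (Primrec.list_getD 0).comp Primrec.snd (hf.comp Primrec.fst)
    exact ((Primrec.nat_lt.comp (hx.comp Primrec.fst) len).and
      ((Primrec.nat_lt.comp (hy.comp Primrec.fst) len).and
        (Primrec.nat_lt.comp (hz.comp Primrec.fst) len))).not.or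
      (hP.comp Primrec.fst ((get hx).pair ((get hy).pair (get hz))))
  · by_cases hs : x a < s.length ∧ y a < s.length ∧ z a < s.length
    · have hl := hst.length_le
      rcases h with h | h
      · exact (h ⟨hs.1.trans_le hl, hs.2.1.trans_le hl, hs.2.2.trans_le hl⟩).elim
      · rw [getD_eq_of_isPrefix hst hs.1, getD_eq_of_isPrefix hst hs.2.1,
          getD_eq_of_isPrefix hst hs.2.2] at h
        exact Or.inr h
    · exact Or.inl hs
  · simp only [Set.mem_ofPred_eq, length_segment]
    constructor
    · intro h l
      by_cases hs : x a < l ∧ y a < l ∧ z a < l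
      · rw [getD_segment _ _ hs.1, getD_segment _ _ hs.2.1, getD_segment _ _ hs.2.2]
        exact Or.inr h
      · exact Or.inl hs
    · intro h
      have hs : x a < x a + y a + z a + 1 ∧ y a < x a + y a + z a + 1 ∧
        z a < x a + y a + z a + 1 := by omega
      have := (h (x a + y a + z a + 1)).resolve_left (not_not.2 hs)
      rwa [getD_segment _ _ hs.1, getD_segment _ _ hs.2.1, getD_segment _ _ hs.2.2] at this

end EffectivelyClosed

/-! ### Storing truth values and counterexamples in one function. -/

namespace SetFormula

/-- An injective translation into arithmetical formulas. -/
def skeleton : {k : ℕ} → SetFormula k → Formula k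
  | _, .eq t u => .eq t u
  | _, .lt t u => .lt t u
  | _, .mem t => .or (.eq t t) (.eq t t)
  | _, .neg φ => .neg φ.skeleton
  | _, .and φ ψ => .and φ.skeleton ψ.skeleton
  | _, .all φ => .all φ.skeleton

theorem skeleton_injective {k : ℕ} : Function.Injective (skeleton (k := k)) := by
  intro φ
  induction φ with
  | eq t u => intro ψ h; cases ψ <;> simp_all [skeleton]
  | lt t u => intro ψ h; cases ψ <;> simp_all [skeleton]
  | mem t => intro ψ h; cases ψ <;> simp_all [skeleton]
  | neg φ ih =>
    intro ψ h
    cases ψ <;> simp [skeleton] at h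
    rw [ih h]
  | and φ χ ih1 ih2 =>
    intro ψ h
    cases ψ <;> simp [skeleton] at h
    rw [ih1 h.1, ih2 h.2]
  | all φ ih =>
    intro ψ h
    cases ψ <;> simp [skeleton] at h
    rw [ih h]

/-- A nonzero number that identifies the formula. -/
def key (x : Σ k, SetFormula k) : ℕ := Nat.pair x.1 x.2.skeleton.code + 1

/-- `Formula.code` does not record the number of free variables, which is why `key` pairs it in. -/
theorem key_injective : Function.Injective key := by
  rintro ⟨k, φ⟩ ⟨m, ψ⟩ h
  obtain ⟨h1, h2⟩ := Nat.pair_eq_pair.1 (Nat.succ_injective h)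
  obtain rfl : k = m := h1
  have h3 : φ = ψ := skeleton_injective (Formula.code_injective h2)
  rw [h3]

/-- The place where the truth value of `φ` for the assignment coded by `c` is stored. -/
def node {k : ℕ} (φ : SetFormula k) (c : ℕ) : ℕ := Nat.pair (key ⟨k, φ⟩) c

/-- The function `g` stores truth values for `φ` and its subformulas: `0` means true, and
for a false universal formula, `n + 1` means that `n` is a counterexample. The predicate symbol is
interpreted by the set of all `x` with `g (Nat.pair 0 x) = 0`. -/
def Evaluates (g : ℕ → ℕ) : {k : ℕ} → SetFormula k → Prop
  | k, .eq t u => ∀ c, g (node (.eq t u) c) = 0 ↔ t.val (tuple k c) = u.val (tuple k c)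
  | k, .lt t u => ∀ c, g (node (.lt t u) c) = 0 ↔ t.val (tuple k c) < u.val (tuple k c)
  | k, .mem t => ∀ c, g (node (.mem t) c) = 0 ↔ g (Nat.pair 0 (t.val (tuple k c))) = 0
  | _, .neg φ => Evaluates g φ ∧ ∀ c, g (node (.neg φ) c) = 0 ↔ ¬ g (node φ c) = 0
  | _, .and φ ψ => (Evaluates g φ ∧ Evaluates g ψ) ∧
      ∀ c, g (node (.and φ ψ) c) = 0 ↔ g (node φ c) = 0 ∧ g (node ψ c) = 0
  | _, .all φ => Evaluates g φ ∧ ∀ c n,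
      (¬ g (node (.all φ) c) = 0 ∨ g (node φ (Nat.pair c n)) = 0) ∧
      (¬ g (node (.all φ) c) = n + 1 ∨ ¬ g (node φ (Nat.pair c n)) = 0)

/-- Storing a counterexample turns the falsity of a universal formula into a condition on single
values, so all clauses of `Evaluates` are closed conditions and yet force correct truth values. -/
theorem Evaluates.holds_iff {g : ℕ → ℕ} {k : ℕ} {φ : SetFormula k} (h : Evaluates g φ) (c : ℕ) :
    g (node φ c) = 0 ↔ φ.Holds {x | g (Nat.pair 0 x) = 0} (tuple k c) := by
  induction φ generalizing c with
  | eq t u => exact h c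
  | lt t u => exact h c
  | mem t => exact h c
  | neg φ ih => exact (h.2 c).trans (not_congr (ih h.1 c))
  | and φ ψ ihφ ihψ => exact (h.2 c).trans (and_congr (ihφ h.1.1 c) (ihψ h.1.2 c))
  | all φ ih =>
    have ih' (n : ℕ) := ih h.1 (Nat.pair c n)
    simp only [tuple_pair] at ih'
    constructor
    · intro h0 n
      exact (ih' n).1 ((h.2 c n).1.resolve_left (not_not.2 h0))
    · intro hall
      by_contra h0
      obtain ⟨n, hn⟩ := Nat.exists_eq_succ_of_ne_zero h0
      exact (h.2 c n).2.elim (fun h1 => h1 hn) fun h1 => h1 ((ih' n).2 (hall n))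

/-- A false universal formula gets `n + 1` for a counterexample `n`; other false formulas get `1`.
-/
theorem exists_value (X : Set ℕ) (x : Σ k, SetFormula k) (c : ℕ) : ∃ v : ℕ,
    (v = 0 ↔ x.2.Holds X (tuple x.1 c)) ∧ ∀ k (ψ : SetFormula (k + 1)) n, x = ⟨k, .all ψ⟩ →
      v = n + 1 → ¬ ψ.Holds X (Fin.snoc (tuple k c) n) := by
  by_cases h : x.2.Holds X (tuple x.1 c)
  · exact ⟨0, by simp [h], fun _ _ _ _ h => by cases h⟩
  · obtain ⟨k, φ⟩ := x
    cases φ with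
    | all ψ =>
      obtain ⟨n, hn⟩ := not_forall.1 h
      refine ⟨n + 1, by simp [h], ?_⟩
      rintro k ψ m ⟨⟩ hm
      rwa [← Nat.succ_injective hm]
    | _ => exact ⟨1, by simp [h], by rintro k ψ n ⟨⟩⟩

theorem exists_evaluates (X : Set ℕ) : ∃ g : ℕ → ℕ, (∀ x, g (Nat.pair 0 x) = 0 ↔ x ∈ X) ∧
    ∀ {k : ℕ} (φ : SetFormula k), Evaluates g φ := by
  classical
  choose v hv hv' using exists_value X
  let g (n : ℕ) : ℕ := Function.extend key v (fun _ x => if x ∈ X then 0 else 1)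
    n.unpair.1 n.unpair.2
  have hX (x : ℕ) : g (Nat.pair 0 x) = 0 ↔ x ∈ X := by
    simp only [g, Nat.unpair_pair]
    -- Keys are never `0`, so the places `Nat.pair 0 x` are free for the set `X`.
    rw [Function.extend_apply' _ _ _ (by rintro ⟨a, ha⟩; exact Nat.succ_ne_zero _ ha)]
    simp
  have hg {k : ℕ} (φ : SetFormula k) (c : ℕ) : g (node φ c) = v ⟨k, φ⟩ c := by
    simp only [g, node, Nat.unpair_pair]
    rw [key_injective.extend_apply]
  have hg0 {k : ℕ} (φ : SetFormula k) (c : ℕ) : g (node φ c) = 0 ↔ φ.Holds X (tuple k c) := by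
    rw [hg]
    exact hv ⟨k, φ⟩ c
  refine ⟨g, hX, fun φ => ?_⟩
  induction φ with
  | eq t u => exact fun c => hg0 _ c
  | lt t u => exact fun c => hg0 _ c
  | mem t => exact fun c => (hg0 _ c).trans (hX _).symm
  | neg φ ih => exact ⟨ih, fun c => (hg0 _ c).trans (not_congr (hg0 φ c).symm)⟩
  | and φ ψ ihφ ihψ =>
    exact ⟨⟨ihφ, ihψ⟩, fun c => (hg0 _ c).trans (and_congr (hg0 φ c).symm (hg0 ψ c).symm)⟩
  | all φ ih =>
    refine ⟨ih, fun c n => ?_⟩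
    rw [hg0, hg0, tuple_pair, hg]
    refine ⟨(em _).symm.imp_right fun h => h n, ?_⟩
    by_cases h : v ⟨_, .all φ⟩ c = n + 1
    · exact Or.inr (hv' _ _ _ φ n rfl h)
    · exact Or.inl h

theorem primrec_val {k : ℕ} (t : Term k) : Primrec fun c => t.val (tuple k c) := by
  induction t with
  | var i => exact primrec_tuple_apply i
  | zero => exact Primrec.const 0
  | one => exact Primrec.const 1
  | add t u iht ihu => exact Primrec.nat_add.comp iht ihu
  | mul t u iht ihu => exact Primrec.nat_mul.comp iht ihu

theorem primrec_node {k : ℕ} (φ : SetFormula k) : Primrec (node φ) :=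
  Primrec₂.natPair.comp (Primrec.const _) Primrec.id

/-- Each clause is a number-indexed conjunction of primitive recursive conditions on at most three
values of `g`. -/
theorem effectivelyClosed_evaluates {k : ℕ} (φ : SetFormula k) : ∀ {α : Type} [Primcodable α],
    EffectivelyClosed fun _ : α => {g | Evaluates g φ} := by
  have iff {β : Type} [Primcodable β] {p q : β → Prop} (hp : PrimrecPred p) (hq : PrimrecPred q) :
      PrimrecPred fun b => p b ↔ q b :=
    ((hp.and hq).or (hp.not.and hq.not)).of_eq fun b => iff_iff_and_or_not_and_not.symm
  have v1 {β : Type} [Primcodable β] : PrimrecPred fun x : β × ℕ × ℕ × ℕ => x.2.1 = 0 :=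
    Primrec.eq.comp (Primrec.fst.comp Primrec.snd) (Primrec.const 0)
  have v2 {β : Type} [Primcodable β] : PrimrecPred fun x : β × ℕ × ℕ × ℕ => x.2.2.1 = 0 :=
    Primrec.eq.comp (Primrec.fst.comp (Primrec.snd.comp Primrec.snd)) (Primrec.const 0)
  have v3 {β : Type} [Primcodable β] : PrimrecPred fun x : β × ℕ × ℕ × ℕ => x.2.2.2 = 0 :=
    Primrec.eq.comp (Primrec.snd.comp (Primrec.snd.comp Primrec.snd)) (Primrec.const 0)
  induction φ with
  | eq t u =>
    intro α _
    have nd := (primrec_node (.eq t u)).comp (Primrec.snd (α := α))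
    exact .iInter (.of_values nd nd nd (P := fun x y =>
      y.1 = 0 ↔ t.val (tuple _ x.2) = u.val (tuple _ x.2)) (iff v1 (Primrec.eq.comp
        ((primrec_val t).comp (Primrec.snd.comp Primrec.fst))
        ((primrec_val u).comp (Primrec.snd.comp Primrec.fst)))))
  | lt t u =>
    intro α _
    have nd := (primrec_node (.lt t u)).comp (Primrec.snd (α := α))
    exact .iInter (.of_values nd nd nd (P := fun x y =>
      y.1 = 0 ↔ t.val (tuple _ x.2) < u.val (tuple _ x.2)) (iff v1 (Primrec.nat_lt.comp
        ((primrec_val t).comp (Primrec.snd.comp Primrec.fst))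
        ((primrec_val u).comp (Primrec.snd.comp Primrec.fst)))))
  | mem t =>
    intro α _
    have nd := (primrec_node (.mem t)).comp (Primrec.snd (α := α))
    have nd' := (Primrec₂.natPair.comp (Primrec.const 0) (primrec_val t)).comp
      (Primrec.snd (α := α))
    exact .iInter (.of_values nd nd' nd' (P := fun _ y => y.1 = 0 ↔ y.2.1 = 0) (iff v1 v2))
  | neg φ ih =>
    intro α _
    have nd := (primrec_node (.neg φ)).comp (Primrec.snd (α := α))
    have nd' := (primrec_node φ).comp (Primrec.snd (α := α))
    exact ih.inter (.iInter (.of_values nd nd' nd' (P := fun _ y => y.1 = 0 ↔ ¬ y.2.1 = 0)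
      (iff v1 v2.not)))
  | and φ ψ ihφ ihψ =>
    intro α _
    have nd := (primrec_node (.and φ ψ)).comp (Primrec.snd (α := α))
    have nd' := (primrec_node φ).comp (Primrec.snd (α := α))
    have nd'' := (primrec_node ψ).comp (Primrec.snd (α := α))
    exact (ihφ.inter ihψ).inter (.iInter (.of_values nd nd' nd''
      (P := fun _ y => y.1 = 0 ↔ y.2.1 = 0 ∧ y.2.2 = 0) (iff v1 (v2.and v3))))
  | all φ ih =>
    intro α _
    have nd := (primrec_node (.all φ)).comp (Primrec.snd.comp (Primrec.fst (α := α × ℕ) (β := ℕ)))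
    have nd' := (primrec_node φ).comp (Primrec₂.natPair.comp
      (Primrec.snd.comp (Primrec.fst (α := α × ℕ) (β := ℕ))) Primrec.snd)
    have v1' : PrimrecPred fun x : ((α × ℕ) × ℕ) × ℕ × ℕ × ℕ => x.2.1 = x.1.2 + 1 :=
      Primrec.eq.comp (Primrec.fst.comp Primrec.snd)
        (Primrec.succ.comp (Primrec.snd.comp Primrec.fst))
    exact ih.inter (.iInter (.iInter (.of_values nd nd' nd'
      (P := fun x y => (¬ y.1 = 0 ∨ y.2.1 = 0) ∧ (¬ y.1 = x.2 + 1 ∨ ¬ y.2.1 = 0))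
      ((v1.not.or v2).and (v1'.not.or v2.not)))))

end SetFormula

/-- Every `Σ¹₁` set is uniformly reducible to the ill-founded recursive trees. -/
theorem IsSigma11.exists_trees {S : Set ℕ} (hS : IsSigma11 S) : ∃ U : ℕ → Set (List ℕ),
    ComputablePred (fun x : ℕ × List ℕ => x.2 ∈ U x.1) ∧ (∀ n, IsTree (U n)) ∧
      ∀ n, n ∈ S ↔ IllFounded (U n) := by
  obtain ⟨φ, hφ⟩ := hS
  have nd : Primrec fun n => SetFormula.node φ (Nat.pair 0 n) :=
    φ.primrec_node.comp (Primrec₂.natPair.comp (Primrec.const 0) Primrec.id)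
  -- The paths of `K n` are the functions that evaluate `φ` and its subformulas and store the value
  -- true for `φ` at `n`.
  obtain ⟨K, hK, hK', hKC⟩ := (φ.effectivelyClosed_evaluates (α := ℕ)).inter
    (.of_values nd nd nd (P := fun _ y => y.1 = 0)
      (Primrec.eq.comp (Primrec.fst.comp Primrec.snd) (Primrec.const 0)))
  refine ⟨fun n => {s | K n s}, hK.computablePred, fun n => hK' n, fun n => ?_⟩
  have htuple : tuple 1 (Nat.pair 0 n) = ![n] := by
    rw [tuple_pair]
    funext i
    fin_cases i; rfl
  rw [hφ]
  constructor
  · rintro ⟨X, hX⟩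
    obtain ⟨g, hg, hgE⟩ := SetFormula.exists_evaluates X
    refine ⟨g, (hKC n g).1 ⟨hgE φ, ?_⟩⟩
    refine ((hgE φ).holds_iff _).2 ?_
    rw [htuple]
    convert hX using 1
    exact Set.ext hg
  · rintro ⟨g, hg⟩
    obtain ⟨hE, h0⟩ := (hKC n g).2 hg
    refine ⟨{x | g (Nat.pair 0 x) = 0}, ?_⟩
    rw [← htuple]
    exact (hE.holds_iff _).1 h0

end ConstructiveTruth

/-! ### The main theorem. -/

theorem theorem4 :
    (∀ S : Set ℕ, ConstructiveTruth.IsSigma11 S →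
      ManyOneReducible (fun n : ℕ => n ∈ S) ConstructiveTruth.ConstructiveTruthSet) ∧
    (∀ T : Set (List ℕ), ConstructiveTruth.IsRecursiveTree T →
      Nonempty (ConstructiveTruth.Presentation T) ∧
      ∀ D : ConstructiveTruth.Presentation T,
        ConstructiveTruth.IllFounded T ↔ ConstructiveTruth.ConstructivelyTrue D.statement) := by
  open ConstructiveTruth in
  refine ⟨fun S hS => ?_, fun T hT => ⟨?_, fun D =>
    ⟨D.constructivelyTrue_of_illFounded hT, D.illFounded_of_constructivelyTrue⟩⟩⟩
  · obtain ⟨U, hU, hUT, hSU⟩ := hS.exists_trees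
    obtain ⟨D, hD⟩ := exists_presentations hU
    refine ⟨_, hD, fun n => (hSU n).trans ?_⟩
    have hUn : IsRecursiveTree (U n) := by
      refine ⟨hUT n, ?_⟩
      obtain ⟨f, hf, hfU⟩ := ComputablePred.computable_iff.1 hU
      refine ComputablePred.computable_iff.2
        ⟨_, hf.comp (Computable.pair (Computable.const n) Computable.id), ?_⟩
      funext s
      exact congrFun hfU (n, s)
    constructor
    · exact fun h => ⟨_, rfl, (D n).constructivelyTrue_of_illFounded hUn h⟩
    · rintro ⟨φ, hφ, h⟩
      -- A number is the code of at most one sentence, so membership in the truth set concerns `(D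
      -- n).statement` itself.
      rw [Formula.code_injective hφ] at h
      exact (D n).illFounded_of_constructivelyTrue h
  · have hU : ComputablePred fun x : ℕ × List ℕ => x.2 ∈ T := by
      obtain ⟨f, hf, hfT⟩ := ComputablePred.computable_iff.1 hT.2
      refine ComputablePred.computable_iff.2 ⟨_, hf.comp Computable.snd, ?_⟩
      funext x
      exact congrFun hfT x.2
    obtain ⟨D, -⟩ := exists_presentations (U := fun _ => T) hU
    exact ⟨D 0⟩
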